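/- A category $\mathcal A$ is acyclic if its only endomorphisms are the identities and, for objects $x\neq y$, $\mathcal A(y,x)\neq\emptyset$ implies $\mathcal A(x,y)=\emptyset$; it is finite if it has finitely many objects and morphisms. An object $x$ of an acyclic category is a *down beat object* if there is a non-identity morphism $f\colon y\to x$ such that every non-identity morphism $g\colon z\to x$ factors as $g=f\circ\tilde g$ for a unique $\tilde g\colon z\to y$; it is an *up beat object* if it is a down beat object of $\mathcal A^{\mathrm{op}}$; a *beat object* is an object of either kind. $\mathcal A$ is *strongly collapsible* if one can reach a full subcategory with exactly one object from $\mathcal A$ by finitely many steps, each replacing the current full subcategory $\mathcal B$ by the full subcategory $\mathcal B\setminus x$ on the remaining objects, where $x$ is a beat object of $\mathcal B$. An (unordered) $\Delta$-complex $X$ consists of sets $X_n$ ($n\ge 0$) of $n$-simplices, a set $V(\sigma)\subseteq X_0$ of exactly $n+1$ vertices for each $\sigma\in X_n$, with $V(v)=\{v\}$ for $v\in X_0$, and faces $d_v(\sigma)\in X_{n-1}$ for $n\geq 1$, $\sigma\in X_n$, $v\in V(\sigma)$, such that $V(d_v\sigma)=V(\sigma)\setminus\{v\}$ and $d_wd_v\sigma=d_vd_w\sigma$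 for distinct $v,w\in V(\sigma)$ with $n\geq 2$. Let $\preceq$ be the reflexive transitive relation generated by $d_v(\sigma)\preceq\sigma$. A vertex $v$ is *dominated* if there is a vertex $v'\neq v$ such that for every simplex $\sigma$ with $v\preceq\sigma$ there is a unique simplex $\tau$ with $V(\tau)=V(\sigma)\cup\{v'\}$ and $\sigma\preceq\tau$. For a vertex $v$, $X\setminus v$ is the subcomplex of the simplices $\sigma$ with $v\not\preceq\sigma$. $X$ is *strongly collapsible* if one can reach a subcomplex consisting of a single vertex from $X$ by finitely many steps, each replacing the current subcomplex $Y$ by $Y\setminus v$, where $v$ is a dominated vertex of $Y$. The *classifying space* $B\mathcal A$ of an acyclic category $\mathcal A$ is the $\Delta$-complex whose $n$-simplices are the sequences $\sigma=(a_0\xrightarrow{f_1}a_1\to\cdots\xrightarrow{f_n}a_n)$ of composable non-identity morphisms, with $V(\sigma)=\{a_0,\dots,a_n\}$, and where $d_{a_i}(\sigma)$ is obtained by deleting $a_i$: the first (last) morphism is dropped if $i=0$ ($i=n$), and otherwise $f_i,f_{i+1}$ are replaced by $f_{i+1}\circ f_i$. **Theorem.** A finite acyclic category $\mathcal A$ is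 strongly collapsible if and only if its classifying space $B\mathcal A$ is strongly collapsible. -/

import Mathlib

open CategoryTheory

universe u v w

/-! ### Acyclic categories, beat objects and strong collapses -/

/-- A category is acyclic if the existence of a morphism `y ⟶ x` between two different objects
excludes morphisms `x ⟶ y`, and if the only endomorphisms are the identities. -/
class AcyclicCategory (C : Type u) [Category.{v} C] : Prop where
  isEmpty_hom : ∀ x y : C, x ≠ y → Nonempty (y ⟶ x) → IsEmpty (x ⟶ y)
  end_eq_id : ∀ (x : C) (f : x ⟶ x), f = 𝟙 x

namespace AcyclicCategory

/-- `IsIdentity f` says that the morphism `f` is the identity of some object. -/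
inductive IsIdentity {C : Type u} [Category.{v} C] : ∀ {x y : C}, (x ⟶ y) → Prop
  | id (x : C) : IsIdentity (𝟙 x)

/-- `x` is a down beat object: there is a nontrivial `f : y ⟶ x` through which every nontrivial
morphism `g : z ⟶ x` factors uniquely. -/
def IsDownBeatObject {C : Type u} [Category.{v} C] (x : C) : Prop :=
  ∃ (y : C) (f : y ⟶ x), ¬ IsIdentity f ∧
    ∀ (z : C) (g : z ⟶ x), ¬ IsIdentity g → ∃! g' : z ⟶ y, g' ≫ f = g

/-- `x` is an up beat object: the dual notion, for morphisms starting at `x`. -/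
def IsUpBeatObject {C : Type u} [Category.{v} C] (x : C) : Prop :=
  ∃ (y : C) (f : x ⟶ y), ¬ IsIdentity f ∧
    ∀ (z : C) (g : x ⟶ z), ¬ IsIdentity g → ∃! g' : y ⟶ z, f ≫ g' = g

/-- A beat object is a down beat object or an up beat object. -/
def IsBeatObject {C : Type u} [Category.{v} C] (x : C) : Prop :=
  IsDownBeatObject x ∨ IsUpBeatObject x

/-- The full subcategory of `C` on a set `S` of objects. -/
abbrev Full {C : Type u} [Category.{v} C] (S : Set C) : Type u :=
  ObjectProperty.FullSubcategory (C := C) (fun a => a ∈ S)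

/-- Elementary strong collapse between full subcategories of `C` (given by their sets of objects):
`T` is obtained from `S` by removing one object that is a beat object of the full subcategory
on `S`. -/
def ElementaryStrongCollapse {C : Type u} [Category.{v} C] (S T : Set C) : Prop :=
  ∃ x : Full S, IsBeatObject x ∧ T = S \ {x.obj}

/-- Strong collapse: a finite sequence of elementary strong collapses. -/
def StrongCollapse {C : Type u} [Category.{v} C] : Set C → Set C → Prop :=
  Relation.ReflTransGen ElementaryStrongCollapse

/-- An acyclic category is strongly collapsible if it strongly collapses to the full subcategory
on a single object (whose only morphism is then the identity). -/
def StronglyCollapsible (C : Type u) [Category.{v} C] [AcyclicCategory C] : Prop :=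
  ∃ a : C, StrongCollapse (Set.univ : Set C) {a}

end AcyclicCategory

/-! ### Unordered Δ-complexes, dominated vertices and strong collapses -/

/-- An (unordered) Δ-complex. An `n`-simplex `σ` has a set `V σ` of `n + 1` vertices, and for each
vertex `v ∈ V σ` of a simplex of positive dimension there is a face `d σ v` opposite to `v`.
In `d_comm` the hypotheses `hw'`, `hv'` hold exactly when `v ≠ w`. -/
structure DeltaComplex where
  simplex : ℕ → Type w
  V : ∀ {n : ℕ}, simplex n → Set (simplex 0)
  ncard_V : ∀ {n : ℕ} (σ : simplex n), (V σ).ncard = n + 1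
  V_vertex : ∀ v : simplex 0, V v = {v}
  d : ∀ {n : ℕ} (σ : simplex (n + 1)) (v : simplex 0), v ∈ V σ → simplex n
  V_d : ∀ {n : ℕ} (σ : simplex (n + 1)) (v : simplex 0) (hv : v ∈ V σ), V (d σ v hv) = V σ \ {v}
  d_comm : ∀ {n : ℕ} (σ : simplex (n + 2)) (v w : simplex 0) (hv : v ∈ V σ) (hw : w ∈ V σ)
    (hw' : w ∈ V (d σ v hv)) (hv' : v ∈ V (d σ w hw)),
    d (d σ v hv) w hw' = d (d σ w hw) v hv'

namespace DeltaComplex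

/-- The set of all simplices, of all dimensions. -/
abbrev Simplices (X : DeltaComplex.{w}) : Type w := Σ n : ℕ, X.simplex n

/-- A vertex, as a simplex of dimension `0`. -/
abbrev vertex (X : DeltaComplex.{w}) (v : X.simplex 0) : X.Simplices := ⟨0, v⟩

/-- The face relation of codimension one. -/
inductive FaceOne (X : DeltaComplex.{w}) : X.Simplices → X.Simplices → Prop
  | d {n : ℕ} (σ : X.simplex (n + 1)) (v : X.simplex 0) (hv : v ∈ X.V σ) :
      FaceOne X ⟨n, X.d σ v hv⟩ ⟨n + 1, σ⟩

/-- The face relation `σ ≼ τ`: the reflexive and transitive closure of `FaceOne`. -/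
def Face (X : DeltaComplex.{w}) : X.Simplices → X.Simplices → Prop :=
  Relation.ReflTransGen X.FaceOne

theorem Face.V_subset {X : DeltaComplex.{w}} {σ τ : X.Simplices} (h : X.Face σ τ) :
    X.V σ.2 ⊆ X.V τ.2 := by
  induction h with
  | refl => exact subset_rfl
  | tail _ h ih =>
    obtain ⟨ρ, v, hv⟩ := h
    refine ih.trans ?_
    simp only [X.V_d]
    exact Set.sdiff_subset

theorem vertex_face_iff (X : DeltaComplex.{w}) (v : X.simplex 0) (σ : X.Simplices) :
    X.Face (X.vertex v) σ ↔ v ∈ X.V σ.2 := by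
  constructor
  · intro h
    exact h.V_subset (by simp [X.V_vertex])
  · obtain ⟨n, σ⟩ := σ
    induction n with
    | zero =>
      intro h
      simp only [X.V_vertex, Set.mem_singleton_iff] at h
      subst h
      exact Relation.ReflTransGen.refl
    | succ n ih =>
      intro h
      have hc := X.ncard_V σ
      obtain ⟨a, ha, hav⟩ := Set.exists_ne_of_one_lt_ncard (s := X.V σ) (by omega) v
      refine Relation.ReflTransGen.tail (ih (X.d σ a ha) ?_) (FaceOne.d σ a ha)
      simp only [X.V_d]
      exact ⟨h, fun h' => hav h'.symm⟩

/-- `v` is dominated by another vertex `v'`: every simplex `σ` that contains `v` is a face of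
a unique simplex `τ` with vertex set `V σ ∪ {v'}`. -/
def IsDominatedBy (X : DeltaComplex.{w}) (v v' : X.simplex 0) : Prop :=
  v ≠ v' ∧ ∀ σ : X.Simplices, X.Face (X.vertex v) σ →
    ∃! τ : X.Simplices, X.V τ.2 = X.V σ.2 ∪ {v'} ∧ X.Face σ τ

/-- `v` is a dominated vertex of `X`. -/
def IsDominated (X : DeltaComplex.{w}) (v : X.simplex 0) : Prop :=
  ∃ v' : X.simplex 0, X.IsDominatedBy v v'

/-- A subcomplex: a family of sets of simplices closed under taking vertices and faces. -/
@[ext]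
structure Subcomplex (X : DeltaComplex.{w}) where
  carrier : ∀ n : ℕ, Set (X.simplex n)
  vertex_mem : ∀ {n : ℕ} (σ : X.simplex n), σ ∈ carrier n → ∀ v ∈ X.V σ, v ∈ carrier 0
  d_mem : ∀ {n : ℕ} (σ : X.simplex (n + 1)), σ ∈ carrier (n + 1) →
    ∀ (v : X.simplex 0) (hv : v ∈ X.V σ), X.d σ v hv ∈ carrier n

namespace Subcomplex

/-- A subcomplex is a Δ-complex, with the restrictions of `V` and `d`. -/
def toDeltaComplex {X : DeltaComplex.{w}} (Y : X.Subcomplex) : DeltaComplex.{w} where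
  simplex n := Y.carrier n
  V σ := {v | v.1 ∈ X.V σ.1}
  ncard_V {n} σ := by
    rw [← X.ncard_V σ.1]
    exact Set.ncard_preimage_of_injective_subset_range Subtype.val_injective
      (fun v hv => ⟨⟨v, Y.vertex_mem σ.1 σ.2 v hv⟩, rfl⟩)
  V_vertex v := by
    ext a
    simp [X.V_vertex, Subtype.ext_iff]
  d σ v hv := ⟨X.d σ.1 v.1 hv, Y.d_mem σ.1 σ.2 v.1 hv⟩
  V_d σ v hv := by
    ext a
    simp [X.V_d, Subtype.ext_iff]
  d_comm σ v a hv ha ha' hv' := Subtype.ext (X.d_comm σ.1 v.1 a.1 hv ha ha' hv')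

/-- The whole complex, as a subcomplex of itself. -/
def whole (X : DeltaComplex.{w}) : X.Subcomplex where
  carrier _ := Set.univ
  vertex_mem _ _ _ _ := Set.mem_univ _
  d_mem _ _ _ _ := Set.mem_univ _

/-- `Y ∖ v`: delete from `Y` all simplices that have `v` as a face. -/
def delete {X : DeltaComplex.{w}} (Y : X.Subcomplex) (v : X.simplex 0) : X.Subcomplex where
  carrier n := {σ | σ ∈ Y.carrier n ∧ ¬ X.Face (X.vertex v) ⟨n, σ⟩}
  vertex_mem {n} σ hσ a ha := ⟨Y.vertex_mem σ hσ.1 a ha, fun h =>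
    hσ.2 (Relation.ReflTransGen.trans h ((X.vertex_face_iff a ⟨n, σ⟩).2 ha))⟩
  d_mem {_} σ hσ a ha := ⟨Y.d_mem σ hσ.1 a ha, fun h =>
    hσ.2 (Relation.ReflTransGen.tail h (FaceOne.d σ a ha))⟩

/-- Elementary strong collapse between subcomplexes: `Z = Y ∖ v` for a vertex `v` that is dominated
in the Δ-complex `Y`. -/
def ElementaryStrongCollapse {X : DeltaComplex.{w}} (Y Z : X.Subcomplex) : Prop :=
  ∃ v : Y.toDeltaComplex.simplex 0, Y.toDeltaComplex.IsDominated v ∧ Z = Y.delete v.1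

/-- Strong collapse: a finite sequence of elementary strong collapses. -/
def StrongCollapse {X : DeltaComplex.{w}} : X.Subcomplex → X.Subcomplex → Prop :=
  Relation.ReflTransGen ElementaryStrongCollapse

/-- The subcomplex consists of a single vertex. -/
def IsSingleVertex {X : DeltaComplex.{w}} (Y : X.Subcomplex) : Prop :=
  (∃ v : X.simplex 0, Y.carrier 0 = {v}) ∧ ∀ n : ℕ, Y.carrier (n + 1) = ∅

end Subcomplex

/-- A Δ-complex is strongly collapsible if it strongly collapses to a single vertex. -/
def StronglyCollapsible (X : DeltaComplex.{w}) : Prop :=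
  ∃ Y : X.Subcomplex, Subcomplex.StrongCollapse (Subcomplex.whole X) Y ∧ Y.IsSingleVertex

end DeltaComplex

/-! ### The classifying space of an acyclic category -/

namespace AcyclicCategory

/-- An `n`-simplex of the classifying space: a sequence `a₀ ⟶ a₁ ⟶ ⋯ ⟶ aₙ` of `n` composable
morphisms, none of which is an identity. -/
def Chain (C : Type u) [Category.{v} C] (n : ℕ) : Type (max u v) :=
  {s : ComposableArrows C n //
    ∀ i : Fin n, ¬ IsIdentity (s.map (homOfLE (Fin.castSucc_le_succ i)))}

namespace Chain

variable {C : Type u} [Category.{v} C]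

/-- The `i`-th object `aᵢ` of the sequence. -/
def obj {n : ℕ} (s : Chain C n) (i : Fin (n + 1)) : C := s.1.obj i

/-- An object, as a sequence of length zero. -/
def ofObj (a : C) : Chain C 0 := ⟨ComposableArrows.mk₀ a, fun i => i.elim0⟩

theorem ofObj_injective : Function.Injective (ofObj : C → Chain C 0) := fun _ _ h =>
  congrArg (fun s : Chain C 0 => s.obj 0) h

theorem ofObj_obj (s : Chain C 0) : ofObj (s.obj 0) = s :=
  Subtype.ext (ComposableArrows.ext₀ rfl)

theorem isIdentity_of_eq [AcyclicCategory C] {x y : C} (f : x ⟶ y) (h : x = y) :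
    IsIdentity f := by
  subst h
  rw [end_eq_id x f]
  exact IsIdentity.id x

theorem ne_of_isIdentity {x y : C} {f : x ⟶ y} (h : IsIdentity f) : x = y := by
  cases h
  rfl

theorem obj_injective [AcyclicCategory C] {n : ℕ} (s : Chain C n) :
    Function.Injective s.obj := by
  have key : ∀ i j : Fin (n + 1), i < j → s.obj i ≠ s.obj j := by
    intro i j hij heq
    obtain ⟨k, rfl⟩ : ∃ k : Fin n, k.castSucc = i :=
      ⟨i.castPred (Fin.ne_last_of_lt hij), Fin.castSucc_castPred _ _⟩
    have hne : s.obj k.castSucc ≠ s.obj k.succ := fun h =>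
      s.2 k (isIdentity_of_eq _ h)
    have f : s.obj k.succ ⟶ s.obj j := s.1.map (homOfLE (Fin.castSucc_lt_iff_succ_le.1 hij))
    rw [← heq] at f
    exact (isEmpty_hom _ _ hne ⟨f⟩).elim (s.1.map (homOfLE (Fin.castSucc_le_succ k)))
  intro i j h
  rcases lt_trichotomy i j with hij | hij | hij
  · exact (key i j hij h).elim
  · exact hij
  · exact (key j i hij h.symm).elim

/-- The sequence obtained by keeping only the objects with index in the range of `e` and composing
the morphisms in between. -/
def restrict [AcyclicCategory C] {m n : ℕ} (s : Chain C n) (e : Fin (m + 1) ↪o Fin (n + 1)) :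
    Chain C m :=
  ⟨e.monotone.functor ⋙ s.1, fun i h => by
    have h1 : s.obj (e i.castSucc) = s.obj (e i.succ) := ne_of_isIdentity h
    have h2 := e.injective (s.obj_injective h1)
    exact absurd h2 (Fin.castSucc_lt_succ (i := i)).ne⟩

/-- Delete the `i`-th object of the sequence: the first or last morphism is dropped if `i` is an end
of the sequence, and otherwise the two morphisms at the `i`-th object are composed. -/
def face [AcyclicCategory C] {n : ℕ} (s : Chain C (n + 1)) (i : Fin (n + 2)) : Chain C n :=
  s.restrict (Fin.succAboveOrderEmb i)

/-- The set of vertices `{a₀, …, aₙ}`, where an object counts as a sequence of length zero. -/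
def vertices {n : ℕ} (s : Chain C n) : Set (Chain C 0) := Set.range fun i => ofObj (s.obj i)

/-- The position of a vertex in the sequence; it is unique when the category is acyclic, see
`obj_injective`. -/
noncomputable def index {n : ℕ} (s : Chain C n) (x : Chain C 0) (hx : x ∈ s.vertices) :
    Fin (n + 1) := Classical.choose hx

theorem ofObj_obj_index {n : ℕ} (s : Chain C n) (x : Chain C 0) (hx : x ∈ s.vertices) :
    ofObj (s.obj (s.index x hx)) = x := Classical.choose_spec hx

theorem vertices_restrict [AcyclicCategory C] {m n : ℕ} (s : Chain C n)
    (e : Fin (m + 1) ↪o Fin (n + 1)) :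
    (s.restrict e).vertices = (fun i => ofObj (s.obj i)) '' Set.range e := by
  rw [← Set.range_comp]
  rfl

theorem ofObj_comp_obj_injective [AcyclicCategory C] {n : ℕ} (s : Chain C n) :
    Function.Injective fun i => ofObj (s.obj i) :=
  ofObj_injective.comp s.obj_injective

theorem vertices_face [AcyclicCategory C] {n : ℕ} (s : Chain C (n + 1)) (i : Fin (n + 2)) :
    (s.face i).vertices = s.vertices \ {ofObj (s.obj i)} := by
  rw [face, vertices_restrict]
  have : Set.range (Fin.succAboveOrderEmb i) = {i}ᶜ := Fin.range_succAbove i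
  rw [this, Set.image_compl_eq_range_sdiff_image s.ofObj_comp_obj_injective, Set.image_singleton]
  rfl

theorem restrict_eq_of_vertices_eq [AcyclicCategory C] {m n : ℕ} (s : Chain C n)
    (e e' : Fin (m + 1) ↪o Fin (n + 1))
    (h : (s.restrict e).vertices = (s.restrict e').vertices) : s.restrict e = s.restrict e' := by
  rw [vertices_restrict, vertices_restrict] at h
  have h' := s.ofObj_comp_obj_injective.image_injective h
  rw [OrderEmbedding.range_inj.1 h']

end Chain

/-- The classifying space `BC` of an acyclic category. The face `d σ x` is obtained from `σ` by
deleting the object `x`; its position in `σ` is unique since the objects of `σ` are distinct. -/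
noncomputable def classifyingSpace (C : Type u) [Category.{v} C] [AcyclicCategory C] :
    DeltaComplex.{max u v} where
  simplex n := Chain C n
  V s := s.vertices
  ncard_V {n} s := by
    have h := Set.ncard_image_of_injective Set.univ s.ofObj_comp_obj_injective
    rw [Set.image_univ, Set.ncard_univ, Nat.card_eq_fintype_card, Fintype.card_fin] at h
    exact h
  V_vertex s := by
    ext t
    constructor
    · rintro ⟨i, rfl⟩
      rw [Fin.fin_one_eq_zero i]
      exact s.ofObj_obj
    · rintro rfl
      exact ⟨0, Chain.ofObj_obj _⟩
  d s x hx := s.face (s.index x hx)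
  V_d s x hx := by
    rw [Chain.vertices_face, Chain.ofObj_obj_index]
  d_comm s x y hx hy hy' hx' := by
    refine Chain.restrict_eq_of_vertices_eq s
      ((Fin.succAboveOrderEmb (Chain.index _ y hy')).trans (Fin.succAboveOrderEmb (s.index x hx)))
      ((Fin.succAboveOrderEmb (Chain.index _ x hx')).trans (Fin.succAboveOrderEmb (s.index y hy)))
      (((s.face (s.index x hx)).vertices_face (Chain.index _ y hy')).trans
        (Eq.trans ?_ ((s.face (s.index y hy)).vertices_face (Chain.index _ x hx')).symm))
    rw [Chain.vertices_face, Chain.vertices_face, Chain.ofObj_obj_index, Chain.ofObj_obj_index,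
      Chain.ofObj_obj_index, Chain.ofObj_obj_index]
    exact Set.sdiff_sdiff_comm

end AcyclicCategory

/-! ### Acyclicity, beat objects and (co)reflective subcategories. -/

namespace AcyclicCategory

variable {C : Type u} [Category.{v} C]

/-! The invariant behind both directions is contractibility: a zigzag of natural transformations
joins the identity functor to a constant functor. An adjunction transports it both ways, since unit
and counit are one-step zigzags. Deleting a beat object leaves a coreflective or reflective full
subcategory, so contractibility is preserved and reflected. A finite acyclic category without beat
objects is rigid: any natural transformation to or from its identity functor is invertible, so if
contractible it has only one object. Hence strong collapsibility of the category amounts to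
contractibility (`stronglyCollapsible_iff`).

A beat object is a dominated vertex, because its universal arrow `y ⟶ x` gives the only way to
insert `y` into a simplex containing `x`. This turns collapses of the category into collapses of the
complex.

A dominated vertex `x` need not be a beat object. If `y ⟶ x` exists, however, removing `x` together
with every object other than `y` lying between `y` and `x` leaves a coreflective subcategory of the
whole (`IsThreadDominatedBy.coreflective`). It is also coreflective in the complement of `x`, so
contractibility passes from that complement to the whole. Reading a collapse of the complex
backwards from its last vertex shows that the category is contractible.

To avoid index bookkeeping, a simplex is replaced by the set of all composites of its arrows, a
thread; faces then become inclusions. -/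

theorem eq_of_hom [AcyclicCategory C] {x y : C} (f : x ⟶ y) (g : y ⟶ x) : x = y := by
  by_contra h
  exact (isEmpty_hom x y h ⟨g⟩).false f

theorem hom_eq_of_hom [AcyclicCategory C] {x y : C} (f f' : x ⟶ y) (g : y ⟶ x) : f = f' := by
  obtain rfl := eq_of_hom f g
  rw [end_eq_id x f, end_eq_id x f']

theorem isIdentity_iff [AcyclicCategory C] {x y : C} (f : x ⟶ y) : IsIdentity f ↔ x = y :=
  ⟨Chain.ne_of_isIdentity, Chain.isIdentity_of_eq f⟩

theorem isIso_iff_eq [AcyclicCategory C] {x y : C} (f : x ⟶ y) : IsIso f ↔ x = y := by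
  constructor
  · intro h
    exact eq_of_hom f (inv f)
  · rintro rfl
    rw [end_eq_id x f]
    infer_instance

instance instOpposite [AcyclicCategory C] : AcyclicCategory Cᵒᵖ where
  isEmpty_hom _ _ h := fun ⟨f⟩ => ⟨fun g => h (Opposite.unop_injective (eq_of_hom f.unop g.unop))⟩
  end_eq_id x f := Quiver.Hom.unop_inj (end_eq_id x.unop f.unop)

instance instFull [AcyclicCategory C] (S : Set C) : AcyclicCategory (Full S) where
  isEmpty_hom _ _ h := fun ⟨f⟩ => ⟨fun g =>
    h (ObjectProperty.FullSubcategory.ext (eq_of_hom g.hom f.hom))⟩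
  end_eq_id x f := ObjectProperty.hom_ext _ (end_eq_id x.obj f.hom)

/-- The inclusion of the full subcategory on `T` into the one on `S` is coreflective. -/
def Coreflective (T S : Set C) : Prop :=
  T ⊆ S ∧ ∀ x ∈ S, ∃ y ∈ T, ∃ f : y ⟶ x, ∀ z ∈ T, ∀ g : z ⟶ x, ∃! g' : z ⟶ y, g' ≫ f = g

/-- The inclusion of the full subcategory on `T` into the one on `S` is reflective. -/
def Reflective (T S : Set C) : Prop :=
  T ⊆ S ∧ ∀ x ∈ S, ∃ y ∈ T, ∃ f : x ⟶ y, ∀ z ∈ T, ∀ g : x ⟶ z, ∃! g' : y ⟶ z, f ≫ g' = g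

theorem Coreflective.mono {T S S' : Set C} (h : Coreflective T S) (hT : T ⊆ S') (hS : S' ⊆ S) :
    Coreflective T S' :=
  ⟨hT, fun x hx => h.2 x (hS hx)⟩

theorem Reflective.mono {T S S' : Set C} (h : Reflective T S) (hT : T ⊆ S') (hS : S' ⊆ S) :
    Reflective T S' :=
  ⟨hT, fun x hx => h.2 x (hS hx)⟩

theorem coreflective_op_iff {T S : Set C} :
    Coreflective T.op S.op ↔ Reflective T S := by
  constructor
  · rintro ⟨h, H⟩
    refine ⟨fun x hx => h (show Opposite.op x ∈ T.op from hx), fun x hx => ?_⟩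
    obtain ⟨y, hy, f, hf⟩ := H (Opposite.op x) hx
    refine ⟨y.unop, hy, f.unop, fun z hz g => ?_⟩
    obtain ⟨g', h1, h2⟩ := hf (Opposite.op z) hz g.op
    exact ⟨g'.unop, Quiver.Hom.op_inj h1, fun k hk =>
      Quiver.Hom.op_inj (h2 k.op (Quiver.Hom.unop_inj hk))⟩
  · rintro ⟨h, H⟩
    refine ⟨fun x hx => h hx, fun x hx => ?_⟩
    obtain ⟨y, hy, f, hf⟩ := H x.unop hx
    refine ⟨Opposite.op y, hy, f.op, fun z hz g => ?_⟩
    obtain ⟨g', h1, h2⟩ := hf z.unop hz g.unop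
    exact ⟨g'.op, Quiver.Hom.unop_inj h1, fun k hk =>
      Quiver.Hom.unop_inj (h2 k.unop (Quiver.Hom.op_inj hk))⟩

/-- Every object other than `x` is its own coreflection, so the only condition is the one at `x`. By
acyclicity a morphism to `x` is not an identity exactly when its source is not `x`, which turns that
condition into the definition of a down beat object. -/
theorem isDownBeatObject_iff [AcyclicCategory C] {S : Set C} (x : Full S) :
    IsDownBeatObject x ↔ Coreflective (S \ {x.obj}) S := by
  simp only [IsDownBeatObject, isIdentity_iff]
  constructor
  · rintro ⟨y, f, hyx, hf⟩
    have hyx' : y.obj ≠ x.obj := fun h => hyx (ObjectProperty.FullSubcategory.ext h)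
    refine ⟨Set.sdiff_subset, fun w hw => ?_⟩
    by_cases hwx : w = x.obj
    · subst hwx
      refine ⟨y.obj, ⟨y.2, hyx'⟩, f.hom, fun z hz g => ?_⟩
      obtain ⟨g', h1, h2⟩ := hf ⟨z, hz.1⟩ (ObjectProperty.homMk g)
        (fun h => hz.2 (congrArg ObjectProperty.FullSubcategory.obj h))
      refine ⟨g'.hom, congrArg InducedCategory.Hom.hom h1, fun k hk => ?_⟩
      exact congrArg InducedCategory.Hom.hom
        (h2 (ObjectProperty.homMk k) (ObjectProperty.hom_ext _ hk))
    · exact ⟨w, ⟨hw, hwx⟩, 𝟙 w, fun z hz g => ⟨g, by simp, by simp⟩⟩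
  · rintro ⟨-, h⟩
    obtain ⟨y, hy, f, hf⟩ := h x.obj x.2
    refine ⟨⟨y, hy.1⟩, ObjectProperty.homMk f,
      fun h => hy.2 (congrArg ObjectProperty.FullSubcategory.obj h), fun z g hz => ?_⟩
    obtain ⟨g', h1, h2⟩ := hf z.obj ⟨z.2, fun h => hz (ObjectProperty.FullSubcategory.ext h)⟩ g.hom
    exact ⟨ObjectProperty.homMk g', ObjectProperty.hom_ext _ h1, fun k hk =>
      ObjectProperty.hom_ext _ (h2 k.hom (congrArg InducedCategory.Hom.hom hk))⟩

theorem isUpBeatObject_iff [AcyclicCategory C] {S : Set C} (x : Full S) :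
    IsUpBeatObject x ↔ Reflective (S \ {x.obj}) S := by
  simp only [IsUpBeatObject, isIdentity_iff]
  constructor
  · rintro ⟨y, f, hyx, hf⟩
    have hyx' : y.obj ≠ x.obj := fun h => hyx (ObjectProperty.FullSubcategory.ext h.symm)
    refine ⟨Set.sdiff_subset, fun w hw => ?_⟩
    by_cases hwx : w = x.obj
    · subst hwx
      refine ⟨y.obj, ⟨y.2, hyx'⟩, f.hom, fun z hz g => ?_⟩
      obtain ⟨g', h1, h2⟩ := hf ⟨z, hz.1⟩ (ObjectProperty.homMk g)
        (fun h => hz.2 (congrArg ObjectProperty.FullSubcategory.obj h.symm))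
      refine ⟨g'.hom, congrArg InducedCategory.Hom.hom h1, fun k hk => ?_⟩
      exact congrArg InducedCategory.Hom.hom
        (h2 (ObjectProperty.homMk k) (ObjectProperty.hom_ext _ hk))
    · exact ⟨w, ⟨hw, hwx⟩, 𝟙 w, fun z hz g => ⟨g, by simp, by simp⟩⟩
  · rintro ⟨-, h⟩
    obtain ⟨y, hy, f, hf⟩ := h x.obj x.2
    refine ⟨⟨y, hy.1⟩, ObjectProperty.homMk f,
      fun h => hy.2 (congrArg ObjectProperty.FullSubcategory.obj h.symm), fun z g hz => ?_⟩
    obtain ⟨g', h1, h2⟩ :=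
      hf z.obj ⟨z.2, fun h => hz (ObjectProperty.FullSubcategory.ext h.symm)⟩ g.hom
    exact ⟨ObjectProperty.homMk g', ObjectProperty.hom_ext _ h1, fun k hk =>
      ObjectProperty.hom_ext _ (h2 k.hom (congrArg InducedCategory.Hom.hom hk))⟩

theorem elementaryStrongCollapse_iff [AcyclicCategory C] {S T : Set C} :
    ElementaryStrongCollapse S T ↔
      ∃ x ∈ S, T = S \ {x} ∧ (Coreflective T S ∨ Reflective T S) := by
  constructor
  · rintro ⟨x, hx, rfl⟩
    exact ⟨x.obj, x.2, rfl, hx.imp (isDownBeatObject_iff x).1 (isUpBeatObject_iff x).1⟩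
  · rintro ⟨x, hx, rfl, h⟩
    exact ⟨⟨x, hx⟩, h.imp (isDownBeatObject_iff ⟨x, hx⟩).2 (isUpBeatObject_iff ⟨x, hx⟩).2, rfl⟩

/-! ### Zigzags of natural transformations -/

/-- The identity functor is connected to a constant functor by natural transformations. -/
def ZigzagContractible (D : Type u) [Category.{v} D] : Prop :=
  ∃ a : D, Zigzag (𝟭 D) ((Functor.const D).obj a)

/-- The inclusion between the full subcategories on two nested sets of objects. -/
def inclusion {T S : Set C} (h : T ⊆ S) : Full T ⥤ Full S where
  obj x := ⟨x.obj, h x.property⟩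
  map f := ObjectProperty.homMk f.hom

/-- Whiskering the contraction of `B` with `L` and `R` joins `L ⋙ R` to the constant functor at
`R.obj b`. -/
theorem zigzagContractible_of_zigzag {A B : Type u} [Category.{v} A] [Category.{v} B]
    (L : A ⥤ B) (R : B ⥤ A) (h : Zigzag (𝟭 A) (L ⋙ R)) (hB : ZigzagContractible B) :
    ZigzagContractible A := by
  obtain ⟨b, hb⟩ := hB
  have h' := zigzag_obj_of_zigzag ((Functor.whiskeringLeft A B A).obj L)
    (zigzag_obj_of_zigzag ((Functor.whiskeringRight B B A).obj R) hb)
  exact ⟨R.obj b, h.trans (h'.trans (.of_hom { app := fun _ => 𝟙 _ }))⟩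

theorem zigzagContractible_iff_of_adjunction {A B : Type u} [Category.{v} A] [Category.{v} B]
    {L : A ⥤ B} {R : B ⥤ A} (adj : L ⊣ R) : ZigzagContractible A ↔ ZigzagContractible B :=
  ⟨zigzagContractible_of_zigzag R L (.of_inv adj.counit),
    zigzagContractible_of_zigzag L R (.of_hom adj.unit)⟩

/-- The chosen universal arrows `ε` serve as the counit; their universal property is the hom-set
bijection. -/
theorem Coreflective.isLeftAdjoint {T S : Set C} (h : Coreflective T S) :
    (inclusion h.1).IsLeftAdjoint := by
  choose r hr ε hε using fun x : Full S => h.2 x.obj x.2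
  have hbij (X : Full T) (Y : Full S) : Function.Bijective
      (fun g : X ⟶ (⟨r Y, hr Y⟩ : Full T) =>
        (ObjectProperty.homMk (g.hom ≫ ε Y) : (inclusion h.1).obj X ⟶ Y)) := by
    constructor
    · intro g g' hg
      exact ObjectProperty.hom_ext _ ((hε Y X.obj X.2 (g.hom ≫ ε Y)).unique rfl
        (congrArg InducedCategory.Hom.hom hg).symm)
    · intro k
      obtain ⟨g, hg, -⟩ := hε Y X.obj X.2 k.hom
      exact ⟨ObjectProperty.homMk g, ObjectProperty.hom_ext _ hg⟩
  have adj := Adjunction.adjunctionOfEquivRight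
    (F := (inclusion h.1)) (G_obj := fun Y => ⟨r Y, hr Y⟩)
    (fun X Y => (Equiv.ofBijective _ (hbij X Y)).symm) (fun X' X Y f g => by
      rw [Equiv.symm_apply_eq]
      obtain ⟨g, rfl⟩ := (Equiv.ofBijective _ (hbij X Y)).surjective g
      rw [Equiv.symm_apply_apply]
      ext
      exact (Category.assoc _ _ _).symm)
  exact adj.isLeftAdjoint

theorem Reflective.isRightAdjoint {T S : Set C} (h : Reflective T S) :
    (inclusion h.1).IsRightAdjoint := by
  choose r hr η hη using fun x : Full S => h.2 x.obj x.2
  have hbij (Y : Full T) (X : Full S) : Function.Bijective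
      (fun g : (⟨r X, hr X⟩ : Full T) ⟶ Y =>
        (ObjectProperty.homMk (η X ≫ g.hom) : X ⟶ (inclusion h.1).obj Y)) := by
    constructor
    · intro g g' hg
      exact ObjectProperty.hom_ext _ ((hη X Y.obj Y.2 (η X ≫ g.hom)).unique rfl
        (congrArg InducedCategory.Hom.hom hg).symm)
    · intro k
      obtain ⟨g, hg, -⟩ := hη X Y.obj Y.2 k.hom
      exact ⟨ObjectProperty.homMk g, ObjectProperty.hom_ext _ hg⟩
  have adj := Adjunction.adjunctionOfEquivLeft
    (G := (inclusion h.1)) (F_obj := fun X => ⟨r X, hr X⟩)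
    (fun X Y => Equiv.ofBijective _ (hbij Y X)) (fun X Y Y' g k => by
      ext
      exact (Category.assoc _ _ _).symm)
  exact adj.isRightAdjoint

theorem Coreflective.zigzagContractible_iff {T S : Set C} (h : Coreflective T S) :
    ZigzagContractible (Full T) ↔ ZigzagContractible (Full S) :=
  have := h.isLeftAdjoint
  zigzagContractible_iff_of_adjunction (Adjunction.ofIsLeftAdjoint (inclusion h.1))

theorem Reflective.zigzagContractible_iff {T S : Set C} (h : Reflective T S) :
    ZigzagContractible (Full T) ↔ ZigzagContractible (Full S) :=
  have := h.isRightAdjoint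
  (zigzagContractible_iff_of_adjunction
    (Adjunction.ofIsRightAdjoint (inclusion h.1))).symm

theorem zigzagContractible_singleton [AcyclicCategory C] (a : C) :
    ZigzagContractible (Full ({a} : Set C)) := by
  refine ⟨⟨a, rfl⟩, .of_hom
    { app := fun x => ObjectProperty.homMk (eqToHom x.2)
      naturality := fun x y f => ?_ }⟩
  obtain ⟨x, rfl⟩ := x
  obtain ⟨y, rfl⟩ := y
  exact ObjectProperty.hom_ext _ ((end_eq_id _ _).trans (end_eq_id _ _).symm)

/-! ### Categories without beat objects -/

/-- Oriented so that induction treats `x` after the targets of all non-identity arrows leaving `x`.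
-/
theorem wellFounded_hom [AcyclicCategory C] [Finite C] :
    WellFounded fun y x : C => x ≠ y ∧ Nonempty (x ⟶ y) := by
  have : Std.Irrefl fun y x : C => x ≠ y ∧ Nonempty (x ⟶ y) := ⟨fun x h => h.1 rfl⟩
  have : IsTrans C fun y x : C => x ≠ y ∧ Nonempty (x ⟶ y) := ⟨by
    rintro z y x ⟨h1, ⟨g⟩⟩ ⟨h2, ⟨f⟩⟩
    refine ⟨?_, ⟨f ≫ g⟩⟩
    rintro rfl
    exact h2 (eq_of_hom f g)⟩
  exact Finite.wellFounded_of_trans_of_irrefl _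

/-- Suppose `η` is invertible at every target of a non-identity arrow out of `x`, but not at `x`.
Then each such `g : x ⟶ z` factors uniquely through `η.app x`, by naturality and invertibility at
`z`, so `x` would be an up beat object. -/
theorem isIso_of_forall_not_isUpBeatObject [AcyclicCategory C] [Finite C]
    (h : ∀ x : C, ¬ IsUpBeatObject x) {F : C ⥤ C} (η : 𝟭 C ⟶ F) : IsIso η := by
  suffices ∀ x, IsIso (η.app x) from NatIso.isIso_of_isIso_app η
  refine fun x => wellFounded_hom.induction (C := fun x => IsIso (η.app x)) x fun x ih => ?_
  by_contra hx
  have hne : x ≠ F.obj x := fun he => hx ((isIso_iff_eq _).2 he)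
  have hF : IsIso (η.app (F.obj x)) := ih _ ⟨hne, ⟨η.app x⟩⟩
  -- Parallel arrows agree as soon as an arrow goes back; the inverse of `η.app (F.obj x)` provides
  -- one. Uniqueness of the factorization rests on this equality.
  have hη : F.map (η.app x) = η.app (F.obj x) :=
    hom_eq_of_hom (F.map (η.app x)) (η.app (F.obj x)) (inv (η.app (F.obj x)))
  refine h x ⟨F.obj x, η.app x, fun hi => hne ((isIdentity_iff _).1 hi), fun z g hg => ?_⟩
  have hz : IsIso (η.app z) := ih z ⟨fun he => hg ((isIdentity_iff _).2 he), ⟨g⟩⟩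
  refine ⟨F.map g ≫ inv (η.app z), ?_, fun k hk => ?_⟩
  · have h1 : g ≫ η.app z = η.app x ≫ F.map g := η.naturality g
    have h2 : (η.app x ≫ F.map g) ≫ inv (η.app z) = g := by
      rw [← h1]
      exact (Category.assoc _ _ _).trans (by rw [IsIso.hom_inv_id]; exact Category.comp_id g)
    exact (Category.assoc _ _ _).symm.trans h2
  · have h1 : k ≫ η.app z = η.app (F.obj x) ≫ F.map k := η.naturality k
    rw [← hη, ← F.map_comp] at h1
    have h2 : k ≫ η.app z = F.map g := h1.trans (congrArg (fun m => F.map m) hk)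
    exact (IsIso.eq_comp_inv _).2 h2

theorem isDownBeatObject_unop [AcyclicCategory C] {x : Cᵒᵖ} (h : IsUpBeatObject x) :
    IsDownBeatObject x.unop := by
  obtain ⟨y, f, hf, H⟩ := h
  simp only [IsDownBeatObject, isIdentity_iff] at hf H ⊢
  refine ⟨y.unop, f.unop, fun he => hf (Opposite.unop_injective he.symm), fun z g hg => ?_⟩
  obtain ⟨g', h1, h2⟩ := H (Opposite.op z) g.op fun he =>
    hg (congrArg Opposite.unop he.symm)
  exact ⟨g'.unop, Quiver.Hom.op_inj h1, fun k hk =>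
    Quiver.Hom.op_inj (h2 k.op (Quiver.Hom.unop_inj hk))⟩

theorem isIso_of_forall_not_isDownBeatObject [AcyclicCategory C] [Finite C]
    (h : ∀ x : C, ¬ IsDownBeatObject x) {F : C ⥤ C} (η : F ⟶ 𝟭 C) : IsIso η := by
  have : Finite Cᵒᵖ := Finite.of_equiv C Opposite.equivToOpposite
  have hη : IsIso (show 𝟭 Cᵒᵖ ⟶ F.op from NatTrans.op η) :=
    isIso_of_forall_not_isUpBeatObject (fun x hx => h x.unop (isDownBeatObject_unop hx)) _
  suffices ∀ x, IsIso (η.app x) from NatIso.isIso_of_isIso_app η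
  intro x
  have : IsIso ((show 𝟭 Cᵒᵖ ⟶ F.op from NatTrans.op η).app (Opposite.op x)) := inferInstance
  exact (isIso_op_iff (η.app x)).1 this

/-- Along the zigzag every functor stays isomorphic to the identity, by rigidity at each step. An
isomorphism to the constant functor gives arrows both ways between `x` and `a`. -/
theorem eq_of_forall_not_isBeatObject [AcyclicCategory C] [Finite C]
    (h : ∀ x : C, ¬ IsBeatObject x) {a : C}
    (ha : Zigzag (𝟭 C) ((Functor.const C).obj a)) (x : C) : x = a := by
  have key (G : C ⥤ C) (hG : Zigzag (𝟭 C) G) : Nonempty (𝟭 C ≅ G) := by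
    induction hG with
    | refl => exact ⟨Iso.refl _⟩
    | tail _ hz ih =>
      obtain ⟨e⟩ := ih
      obtain ⟨⟨f⟩⟩ | ⟨⟨f⟩⟩ := hz
      · have := isIso_of_forall_not_isUpBeatObject (fun x hx => h x (.inr hx)) (e.hom ≫ f)
        exact ⟨asIso (e.hom ≫ f)⟩
      · have := isIso_of_forall_not_isDownBeatObject (fun x hx => h x (.inl hx)) (f ≫ e.inv)
        exact ⟨(asIso (f ≫ e.inv)).symm⟩
  obtain ⟨e⟩ := key _ ha
  exact eq_of_hom (e.hom.app x) (e.inv.app x)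

theorem StrongCollapse.zigzagContractible [AcyclicCategory C] {S : Set C} {a : C}
    (h : StrongCollapse S {a}) : ZigzagContractible (Full S) := by
  induction h using Relation.ReflTransGen.head_induction_on with
  | refl => exact zigzagContractible_singleton a
  | head h _ ih =>
    obtain ⟨x, hx, rfl, h | h⟩ := elementaryStrongCollapse_iff.1 h
    · exact h.zigzagContractible_iff.1 ih
    · exact h.zigzagContractible_iff.1 ih

/-- Beat objects may be removed in any order: contractibility survives each removal, and rigidity
identifies what remains once none is left. -/
theorem exists_strongCollapse_singleton [AcyclicCategory C] [Finite C] (S : Set C)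
    (hS : ZigzagContractible (Full S)) : ∃ a, StrongCollapse S {a} := by
  induction hn : S.ncard using Nat.strong_induction_on generalizing S with
  | _ n ih =>
    by_cases hb : ∃ x : Full S, IsBeatObject x
    · obtain ⟨x, hx⟩ := hb
      have hstep : ElementaryStrongCollapse S (S \ {x.obj}) := ⟨x, hx, rfl⟩
      have hc : ZigzagContractible (Full (S \ {x.obj})) := by
        rcases hx with hx | hx
        · exact ((isDownBeatObject_iff x).1 hx).zigzagContractible_iff.2 hS
        · exact ((isUpBeatObject_iff x).1 hx).zigzagContractible_iff.2 hS
      obtain ⟨a, ha⟩ := ih _ (hn ▸ Set.ncard_sdiff_singleton_lt_of_mem x.2) _ hc rfl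
      exact ⟨a, .head hstep ha⟩
    · push Not at hb
      obtain ⟨a, ha⟩ := hS
      have : Finite (Full S) := Finite.of_injective ObjectProperty.FullSubcategory.obj
        fun _ _ h => ObjectProperty.FullSubcategory.ext h
      refine ⟨a.obj, ?_⟩
      have hSa : S = {a.obj} := by
        ext x
        refine ⟨fun hx => ?_, ?_⟩
        · exact congrArg ObjectProperty.FullSubcategory.obj
            (eq_of_forall_not_isBeatObject hb ha ⟨x, hx⟩)
        · rintro rfl
          exact a.2
      rw [← hSa]
      exact .refl

theorem stronglyCollapsible_iff [AcyclicCategory C] [Finite C] :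
    StronglyCollapsible C ↔ ZigzagContractible (Full (Set.univ : Set C)) :=
  ⟨fun ⟨_, h⟩ => h.zigzagContractible, exists_strongCollapse_singleton _⟩

end AcyclicCategory

namespace AcyclicCategory

variable {C : Type u} [Category.{v} C]

/-! ### Threads: simplices as sets of morphisms -/

/-- A thread is a nonempty set of morphisms that is a subcategory isomorphic to a total order. The
threads with finitely many objects are the sets of morphisms between the vertices of a simplex of
the classifying space. -/
structure IsThread (W : MorphismProperty C) : Prop where
  nonempty : ∃ a, W (𝟙 a)
  source : ∀ {a b : C} {f : a ⟶ b}, W f → W (𝟙 a)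
  target : ∀ {a b : C} {f : a ⟶ b}, W f → W (𝟙 b)
  comp : ∀ {a b c : C} {f : a ⟶ b} {g : b ⟶ c}, W f → W g → W (f ≫ g)
  parallel : ∀ {a b : C} {f g : a ⟶ b}, W f → W g → f = g
  total : ∀ {a b : C}, W (𝟙 a) → W (𝟙 b) → (∃ f : a ⟶ b, W f) ∨ ∃ f : b ⟶ a, W f

/-- Domination in the classifying space of the full subcategory on `S`, stated for threads. -/
def IsThreadDominatedBy (S : Set C) (x y : C) : Prop :=
  x ∈ S ∧ y ∈ S ∧ x ≠ y ∧ ∀ W : MorphismProperty C, IsThread W → (∀ a, W (𝟙 a) → a ∈ S) →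
    W (𝟙 x) → ∃! W' : MorphismProperty C,
      IsThread W' ∧ (∀ a, W' (𝟙 a) ↔ W (𝟙 a) ∨ a = y) ∧ W ≤ W'

theorem IsThread.op {W : MorphismProperty C} (hW : IsThread W) : IsThread W.op where
  nonempty := let ⟨a, ha⟩ := hW.nonempty; ⟨Opposite.op a, ha⟩
  source h := hW.target h
  target h := hW.source h
  comp h h' := hW.comp h' h
  parallel h h' := Quiver.Hom.unop_inj (hW.parallel h h')
  total h h' := (hW.total h h').symm.imp (fun ⟨f, hf⟩ => ⟨f.op, hf⟩) (fun ⟨f, hf⟩ => ⟨f.op, hf⟩)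

theorem IsThread.unop {W : MorphismProperty Cᵒᵖ} (hW : IsThread W) : IsThread W.unop where
  nonempty := let ⟨a, ha⟩ := hW.nonempty; ⟨a.unop, ha⟩
  source h := hW.target h
  target h := hW.source h
  comp h h' := hW.comp h' h
  parallel h h' := Quiver.Hom.op_inj (hW.parallel h h')
  total h h' := (hW.total h h').symm.imp (fun ⟨f, hf⟩ => ⟨f.unop, hf⟩)
    (fun ⟨f, hf⟩ => ⟨f.unop, hf⟩)

/-- Threads are self-dual, so the reflective statements below follow from the coreflective ones. -/
theorem isThreadDominatedBy_op_iff {S : Set C} {x y : C} :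
    IsThreadDominatedBy S.op (Opposite.op x) (Opposite.op y) ↔ IsThreadDominatedBy S x y := by
  constructor
  · rintro ⟨hx, hy, hxy, H⟩
    refine ⟨hx, hy, fun h => hxy (congrArg _ h), fun W hW hS hWx => ?_⟩
    obtain ⟨W', ⟨h1, h2, h3⟩, h4⟩ := H W.op hW.op (fun a ha => hS a.unop ha) hWx
    refine ⟨W'.unop, ⟨h1.unop, fun a => (h2 (Opposite.op a)).trans ?_, fun a b f hf => h3 _ hf⟩,
      fun V hV => ?_⟩
    · exact or_congr Iff.rfl ⟨congrArg Opposite.unop, congrArg Opposite.op⟩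
    · have := h4 V.op ⟨hV.1.op, fun a => (hV.2.1 a.unop).trans
        (or_congr Iff.rfl ⟨fun h => congrArg Opposite.op h, congrArg Opposite.unop⟩),
        fun a b f hf => hV.2.2 _ hf⟩
      rw [← this]
      rfl
  · rintro ⟨hx, hy, hxy, H⟩
    refine ⟨hx, hy, fun h => hxy (congrArg Opposite.unop h), fun W hW hS hWx => ?_⟩
    obtain ⟨W', ⟨h1, h2, h3⟩, h4⟩ := H W.unop hW.unop (fun a ha => hS (Opposite.op a) ha) hWx
    refine ⟨W'.op, ⟨h1.op, fun a => (h2 a.unop).trans ?_, fun a b f hf => h3 _ hf⟩,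
      fun V hV => ?_⟩
    · exact or_congr Iff.rfl ⟨fun h => congrArg Opposite.op h, congrArg Opposite.unop⟩
    · have := h4 V.unop ⟨hV.1.unop, fun a => (hV.2.1 (Opposite.op a)).trans
        (or_congr Iff.rfl ⟨congrArg Opposite.unop, congrArg Opposite.op⟩),
        fun a b f hf => hV.2.2 _ hf⟩
      rw [← this]
      rfl

/-- The identity of `x`, as a thread. -/
inductive singleThread (x : C) : MorphismProperty C
  | id : singleThread x (𝟙 x)

theorem singleThread_id_iff {x a : C} : singleThread x (𝟙 a) ↔ a = x := by
  refine ⟨fun h => ?_, by rintro rfl; exact .id⟩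
  have key {a b : C} {g : a ⟶ b} (h : singleThread x g) : a = x := by cases h; rfl
  exact key h

/-- Extend `W` by `g : z ⟶ w` and its composites with the morphisms of `W`. -/
inductive consThread (W : MorphismProperty C) {z w : C} (g : z ⟶ w) : MorphismProperty C
  | of {a b : C} (k : a ⟶ b) : W k → consThread W g k
  | id : consThread W g (𝟙 z)
  | comp {b : C} (m : w ⟶ b) : W m → consThread W g (g ≫ m)

section consThread

variable {W : MorphismProperty C} {z w : C} {g : z ⟶ w}

theorem consThread_id_iff (hW : IsThread W) (a : C) :
    consThread W g (𝟙 a) ↔ W (𝟙 a) ∨ a = z := by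
  constructor
  · intro h
    have key {a b : C} {k : a ⟶ b} (h : consThread W g k) : W (𝟙 a) ∨ a = z := by
      cases h with
      | of _ h => exact .inl (hW.source h)
      | id => exact .inr rfl
      | comp _ h => exact .inr rfl
    exact key h
  · rintro (h | rfl)
    · exact .of _ h
    · exact .id

theorem consThread_le {W' : MorphismProperty C} (hW' : IsThread W') (hle : W ≤ W') (hg : W' g) :
    consThread W g ≤ W' := by
  intro a b k h
  cases h with
  | of _ h => exact hle _ h
  | id => exact hW'.source hg
  | comp _ h => exact hW'.comp hg (hle _ h)

end consThread

/-- Insert the object `y` into `W`, just before the target of `f : y ⟶ x`. -/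
inductive insertBefore (W : MorphismProperty C) {x y : C} (f : y ⟶ x) : MorphismProperty C
  | of {a b : C} (g : a ⟶ b) : W g → insertBefore W f g
  | id : insertBefore W f (𝟙 y)
  | toNew {a : C} (k : a ⟶ y) : W (k ≫ f) → insertBefore W f k
  | fromNew {b : C} (m : x ⟶ b) : W m → insertBefore W f (f ≫ m)

section insertBefore

variable {W : MorphismProperty C} {x y : C} {f : y ⟶ x}

theorem insertBefore_id_iff (hW : IsThread W) (a : C) :
    insertBefore W f (𝟙 a) ↔ W (𝟙 a) ∨ a = y := by
  constructor
  · intro h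
    have key {a b : C} {g : a ⟶ b} (h : insertBefore W f g) : W (𝟙 a) ∨ a = y := by
      cases h with
      | of _ h => exact .inl (hW.source h)
      | id => exact .inr rfl
      | toNew _ h => exact .inl (hW.source h)
      | fromNew _ h => exact .inr rfl
    exact key h
  · rintro (h | rfl)
    · exact .of _ h
    · exact .id

end insertBefore

variable [AcyclicCategory C]

/-- Any arrow of `W'` has a counterpart in `W` between the same objects: a parallel one is equal to
it, and an opposite one forces an identity. This gives uniqueness of the extension in the definition
of domination. -/
theorem IsThread.eq_of_le {W W' : MorphismProperty C} (hW : IsThread W) (hW' : IsThread W')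
    (h : W ≤ W') (hobj : ∀ a, W' (𝟙 a) → W (𝟙 a)) : W = W' := by
  refine le_antisymm h fun a b f hf => ?_
  obtain ⟨g, hg⟩ | ⟨g, hg⟩ := hW.total (hobj _ (hW'.source hf)) (hobj _ (hW'.target hf))
  · rwa [hW'.parallel hf (h _ hg)]
  · obtain rfl := eq_of_hom f g
    rwa [end_eq_id _ f, ← end_eq_id _ g]

/-! ### Beat objects are dominated -/

section insertBefore

variable {W : MorphismProperty C} {x y : C} {f : y ⟶ x}

/-- Objects before `x` reach `y` by lifting across `f`, while `x` and the later objects are reached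
from `y` through `f`. Uniqueness of lifts keeps parallel arrows equal; acyclicity excludes the
remaining configurations. -/
theorem isThread_insertBefore (hW : IsThread W) (hx : W (𝟙 x)) (hy : ¬ W (𝟙 y))
    (hf : ∀ z, W (𝟙 z) → z ≠ x → ∀ g : z ⟶ x, ∃! g' : z ⟶ y, g' ≫ f = g) :
    IsThread (insertBefore W f) := by
  have hyx : y ≠ x := by
    rintro rfl
    exact hy hx
  have hinj {z : C} (hz : W (𝟙 z)) {k k' : z ⟶ y} (h : k ≫ f = k' ≫ f) : k = k' := by
    have hzx : z ≠ x := by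
      rintro rfl
      exact hyx (eq_of_hom f k)
    exact (hf z hz hzx (k' ≫ f)).unique h rfl
  have hs {a b : C} {g : a ⟶ b} (h : insertBefore W f g) : insertBefore W f (𝟙 a) := by
    rw [insertBefore_id_iff hW]
    cases h with
    | of _ h => exact .inl (hW.source h)
    | id => exact .inr rfl
    | toNew _ h => exact .inl (hW.source h)
    | fromNew _ h => exact .inr rfl
  have ht {a b : C} {g : a ⟶ b} (h : insertBefore W f g) : insertBefore W f (𝟙 b) := by
    rw [insertBefore_id_iff hW]
    cases h with
    | of _ h => exact .inl (hW.target h)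
    | id => exact .inr rfl
    | toNew _ h => exact .inr rfl
    | fromNew _ h => exact .inl (hW.target h)
  refine ⟨⟨x, .of _ hx⟩, hs, ht, ?_, ?_, ?_⟩
  · intro a b c g g' h h'
    cases h with
    | of _ h =>
      cases h' with
      | of _ h' => exact .of _ (hW.comp h h')
      | id => exact (hy (hW.target h)).elim
      | toNew _ h' => exact .toNew _ (by rw [Category.assoc]; exact hW.comp h h')
      | fromNew _ h' => exact (hy (hW.target h)).elim
    | id => rwa [Category.id_comp]
    | toNew _ h =>
      cases h' with
      | of _ h' => exact (hy (hW.source h')).elim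
      | id => rw [Category.comp_id]; exact .toNew _ h
      | toNew _ h' => exact (hy (hW.source h')).elim
      | fromNew _ h' => rw [← Category.assoc]; exact .of _ (hW.comp h h')
    | fromNew m h =>
      cases h' with
      | of _ h' => rw [Category.assoc]; exact .fromNew _ (hW.comp h h')
      | id => exact (hy (hW.target h)).elim
      | toNew k h' => exact (hyx (eq_of_hom f (m ≫ k))).elim
      | fromNew _ h' => exact (hy (hW.target h)).elim
  · intro a b g g' h h'
    cases h with
    | of _ h =>
      cases h' with
      | of _ h' => exact hW.parallel h h'
      | id => exact (hy (hW.target h)).elim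
      | toNew _ h' => exact (hy (hW.target h)).elim
      | fromNew _ h' => exact (hy (hW.source h)).elim
    | id => exact (end_eq_id _ _).symm
    | toNew _ h =>
      cases h' with
      | of _ h' => exact (hy (hW.target h')).elim
      | id => exact end_eq_id _ _
      | toNew _ h' => exact hinj (hW.source h) (hW.parallel h h')
      | fromNew _ h' => exact (hy (hW.source h)).elim
    | fromNew m h =>
      cases h' with
      | of _ h' => exact (hy (hW.source h')).elim
      | id => exact end_eq_id _ _
      | toNew k h' => exact (hy (hW.source h')).elim
      | fromNew _ h' => rw [hW.parallel h h']
  · have hnew {a : C} (ha : W (𝟙 a)) :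
        (∃ g : a ⟶ y, insertBefore W f g) ∨ ∃ g : y ⟶ a, insertBefore W f g := by
      by_cases hax : a = x
      · subst hax
        exact .inr ⟨_, .fromNew _ ha⟩
      · obtain ⟨g, hg⟩ | ⟨g, hg⟩ := hW.total ha hx
        · obtain ⟨k, rfl, -⟩ := hf a ha hax g
          exact .inl ⟨k, .toNew k hg⟩
        · exact .inr ⟨_, .fromNew g hg⟩
    intro a b ha hb
    rw [insertBefore_id_iff hW] at ha hb
    rcases ha with ha | rfl <;> rcases hb with hb | rfl
    · exact (hW.total ha hb).imp (fun ⟨g, hg⟩ => ⟨g, .of _ hg⟩) (fun ⟨g, hg⟩ => ⟨g, .of _ hg⟩)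
    · exact hnew ha
    · exact (hnew hb).symm
    · exact .inl ⟨_, .id⟩

/-- A thread containing `W` and `y` must relate `y` to `x`, and only `f` can do so. Its arrow from
an earlier object to `y` is then the unique lift across `f`. -/
theorem insertBefore_le {W' : MorphismProperty C} (hW' : IsThread W') (hW : IsThread W)
    (hx : W (𝟙 x)) (hyx : y ≠ x) (hy : W' (𝟙 y)) (hle : W ≤ W')
    (hf : ∀ z, W (𝟙 z) → z ≠ x → ∀ g : z ⟶ x, ∃! g' : z ⟶ y, g' ≫ f = g)
    (hff : ∀ f' : y ⟶ x, f' = f) : insertBefore W f ≤ W' := by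
  have hWf : W' f := by
    obtain ⟨g, hg⟩ | ⟨g, -⟩ := hW'.total hy (hle _ hx)
    · rwa [← hff g]
    · exact (hyx (eq_of_hom f g)).elim
  intro a b g h
  cases h with
  | of _ h => exact hle _ h
  | id => exact hy
  | fromNew _ h => exact hW'.comp hWf (hle _ h)
  | toNew k h =>
    obtain ⟨g', hg'⟩ | ⟨g', hg'⟩ := hW'.total (hle _ (hW.source h)) hy
    · have hax : a ≠ x := by
        rintro rfl
        exact hyx (eq_of_hom f g')
      have := (hf a (hW.source h) hax (g' ≫ f)).unique rfl
        (hW'.parallel (hle _ h) (hW'.comp hg' hWf))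
      rwa [← this]
    · obtain rfl := eq_of_hom k g'
      rwa [end_eq_id _ k]

end insertBefore

theorem Coreflective.isThreadDominatedBy {S : Set C} {x : C} (hx : x ∈ S)
    (h : Coreflective (S \ {x}) S) : ∃ y, IsThreadDominatedBy S x y := by
  obtain ⟨y, ⟨hyS, hyx⟩, f, hf⟩ := h.2 x hx
  refine ⟨y, hx, hyS, fun h => hyx h.symm, fun W hW hWS hWx => ?_⟩
  have hf' (z : C) (hz : W (𝟙 z)) (hzx : z ≠ x) (g : z ⟶ x) : ∃! g' : z ⟶ y, g' ≫ f = g :=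
    hf z ⟨hWS z hz, hzx⟩ g
  -- A factorization of `f'` through `f` uses an endomorphism of `y`, which is an identity.
  have hff (f' : y ⟶ x) : f' = f := by
    obtain ⟨g, hg, -⟩ := hf y ⟨hyS, hyx⟩ f'
    rw [← hg, end_eq_id _ g, Category.id_comp]
  by_cases hy : W (𝟙 y)
  · refine ⟨W, ⟨hW, fun a => ⟨.inl, ?_⟩, le_rfl⟩, fun V ⟨hV, hobj, hle⟩ =>
      (hW.eq_of_le hV hle fun a ha => ?_).symm⟩
    · rintro (h | rfl) <;> assumption
    · rcases (hobj a).1 ha with h | rfl <;> assumption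
  · refine ⟨insertBefore W f, ⟨isThread_insertBefore hW hWx hy hf', insertBefore_id_iff hW,
      fun a b g hg => .of g hg⟩, fun V ⟨hV, hobj, hle⟩ => ?_⟩
    refine ((isThread_insertBefore hW hWx hy hf').eq_of_le hV
      (insertBefore_le hV hW hWx hyx ((hobj y).2 (.inr rfl)) hle hf' hff) fun a ha => ?_).symm
    rw [insertBefore_id_iff hW]
    exact (hobj a).1 ha

theorem Reflective.isThreadDominatedBy {S : Set C} {x : C} (hx : x ∈ S)
    (h : Reflective (S \ {x}) S) : ∃ y, IsThreadDominatedBy S x y := by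
  have h' : Coreflective (S.op \ {Opposite.op x}) S.op := by
    convert coreflective_op_iff.2 h using 1
    ext a
    exact and_congr Iff.rfl (not_congr ⟨fun h => congrArg Opposite.unop h,
      fun h => congrArg Opposite.op h⟩)
  obtain ⟨y, hy⟩ := h'.isThreadDominatedBy (x := Opposite.op x) hx
  exact ⟨y.unop, isThreadDominatedBy_op_iff.1 hy⟩

/-! ### Dominated objects and coreflective subcategories -/

theorem isThread_singleThread (x : C) : IsThread (singleThread x) where
  nonempty := ⟨x, .id⟩
  source := by rintro _ _ _ ⟨⟩; exact .id
  target := by rintro _ _ _ ⟨⟩; exact .id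
  comp := by rintro _ _ _ _ _ ⟨⟩ h; rwa [Category.id_comp]
  parallel := by rintro _ _ _ _ ⟨⟩ h; exact (end_eq_id _ _).symm
  total := by
    intro a b ha hb
    obtain rfl := singleThread_id_iff.1 ha
    obtain rfl := singleThread_id_iff.1 hb
    exact .inl ⟨_, .id⟩

section consThread

variable {W : MorphismProperty C} {z w : C} {g : z ⟶ w}

/-- Since `w` is the first object of `W`, prepending `g` determines an arrow from `z` to every
object. -/
theorem isThread_consThread (hW : IsThread W) (hw : ∀ a, W (𝟙 a) → ∃ m : w ⟶ a, W m)
    (hww : W (𝟙 w)) : IsThread (consThread W g) := by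
  -- If `z` already occurs, the arrow from `w` back to it forces `g` to be an identity, and nothing
  -- is added.
  by_cases hz : W (𝟙 z)
  · obtain ⟨m, hm⟩ := hw z hz
    obtain rfl := eq_of_hom g m
    have : consThread W g = W := by
      refine le_antisymm (consThread_le hW le_rfl ?_) fun a b k hk => .of k hk
      rwa [end_eq_id _ g]
    rwa [this]
  have hs {a b : C} {k : a ⟶ b} (h : consThread W g k) : consThread W g (𝟙 a) := by
    rw [consThread_id_iff hW]
    cases h with
    | of _ h => exact .inl (hW.source h)
    | id => exact .inr rfl
    | comp _ h => exact .inr rfl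
  have ht {a b : C} {k : a ⟶ b} (h : consThread W g k) : consThread W g (𝟙 b) := by
    rw [consThread_id_iff hW]
    cases h with
    | of _ h => exact .inl (hW.target h)
    | id => exact .inr rfl
    | comp _ h => exact .inl (hW.target h)
  refine ⟨⟨w, .of _ hww⟩, hs, ht, ?_, ?_, ?_⟩
  · intro a b c k k' h h'
    cases h with
    | of _ h =>
      cases h' with
      | of _ h' => exact .of _ (hW.comp h h')
      | id => exact (hz (hW.target h)).elim
      | comp _ h' => exact (hz (hW.target h)).elim
    | id => rwa [Category.id_comp]
    | comp _ h =>
      cases h' with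
      | of _ h' => rw [Category.assoc]; exact .comp _ (hW.comp h h')
      | id => exact (hz (hW.target h)).elim
      | comp _ h' => exact (hz (hW.target h)).elim
  · intro a b k k' h h'
    cases h with
    | of _ h =>
      cases h' with
      | of _ h' => exact hW.parallel h h'
      | id => exact (hz (hW.target h)).elim
      | comp _ h' => exact (hz (hW.source h)).elim
    | id => exact (end_eq_id _ _).symm
    | comp _ h =>
      cases h' with
      | of _ h' => exact (hz (hW.source h')).elim
      | id => exact end_eq_id _ _
      | comp _ h' => rw [hW.parallel h h']
  · have hnew {a : C} (ha : W (𝟙 a)) : ∃ k : z ⟶ a, consThread W g k :=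
      let ⟨m, hm⟩ := hw a ha
      ⟨g ≫ m, .comp m hm⟩
    intro a b ha hb
    rw [consThread_id_iff hW] at ha hb
    rcases ha with ha | rfl <;> rcases hb with hb | rfl
    · exact (hW.total ha hb).imp (fun ⟨g, hg⟩ => ⟨g, .of _ hg⟩) (fun ⟨g, hg⟩ => ⟨g, .of _ hg⟩)
    · exact .inr (hnew ha)
    · exact .inl (hnew hb)
    · exact .inl ⟨_, .id⟩

end consThread

/-- Two composable morphisms generate a thread on their objects. -/
theorem exists_isThread {z w x : C} (g : z ⟶ w) (h : w ⟶ x) :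
    ∃ W : MorphismProperty C, IsThread W ∧ W g ∧ W h ∧
      (∀ a, W (𝟙 a) ↔ a = x ∨ a = w ∨ a = z) ∧
      ∀ W' : MorphismProperty C, IsThread W' → W' g → W' h → W ≤ W' := by
  have h0 := isThread_singleThread x
  have h1 : IsThread (consThread (singleThread x) h) :=
    isThread_consThread h0 (fun a ha => ⟨eqToHom (singleThread_id_iff.1 ha).symm, by
      obtain rfl := singleThread_id_iff.1 ha
      exact .id⟩) .id
  have hh : consThread (singleThread x) h h := by
    have : consThread (singleThread x) h (h ≫ 𝟙 x) := .comp _ .id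
    rwa [Category.comp_id] at this
  have h1' := consThread_id_iff (g := h) h0
  have hw := (h1' w).2 (.inr rfl)
  refine ⟨consThread (consThread (singleThread x) h) g,
    isThread_consThread h1 (fun a ha => ?_) hw, ?_, .of _ hh, fun a => ?_, fun W' hW' hg hh =>
      consThread_le hW' (consThread_le hW' ?_ hh) hg⟩
  · rcases (h1' a).1 ha with ha' | rfl
    · obtain rfl := singleThread_id_iff.1 ha'
      exact ⟨h, hh⟩
    · exact ⟨_, ha⟩
  · have : consThread (consThread (singleThread x) h) g (g ≫ 𝟙 w) := .comp _ hw
    rwa [Category.comp_id] at this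
  · rw [consThread_id_iff h1, h1', singleThread_id_iff, or_assoc]
  · rintro a b k ⟨⟩
    exact hW'.target hh

/-- The subcategory is the complement of `I`, and `y` is the coreflection of every object of `I`.
Unique insertion of `y` into small simplices yields uniqueness of arrows and cancellation of `f`;
existence of an insertion into `z ⟶ w ⟶ x` yields the required factorization. -/
theorem IsThreadDominatedBy.coreflective {S : Set C} {x y : C} (hd : IsThreadDominatedBy S x y)
    (f : y ⟶ x) : ∃ T : Set C, T ⊆ S \ {x} ∧ Coreflective T S := by
  obtain ⟨hx, hy, hxy, H⟩ := hd
  let I : Set C := {w | w ≠ y ∧ Nonempty (y ⟶ w) ∧ Nonempty (w ⟶ x)}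
  -- The simplex `w ⟶ x` can be extended by `y` through either `e` or `e'`; the two extensions
  -- coincide.
  have huniq {w : C} (hw : w ∈ S) (h : w ⟶ x) (e e' : y ⟶ w) : e = e' := by
    obtain ⟨W, hW, -, hWh, hobj, hmin⟩ := exists_isThread (𝟙 w) h
    obtain ⟨V, hV, hVe, hVh, hVobj, -⟩ := exists_isThread e h
    obtain ⟨V', hV', hVe', hVh', hVobj', -⟩ := exists_isThread e' h
    have := (H W hW (fun a ha => by rcases (hobj a).1 ha with rfl | rfl | rfl <;> assumption)
      (hW.target hWh)).unique
      ⟨hV, fun a => by rw [hVobj, hobj]; tauto, hmin V hV (hV.target hVe) hVh⟩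
      ⟨hV', fun a => by rw [hVobj', hobj]; tauto, hmin V' hV' (hV'.target hVe') hVh'⟩
    subst this
    exact hV.parallel hVe hVe'
  -- Here the simplex is the composite `z ⟶ x`, with `y` inserted through `k` or through `k'`.
  have hmono {z : C} (hz : z ∈ S) (k k' : z ⟶ y) (h : k ≫ f = k' ≫ f) : k = k' := by
    obtain ⟨W, hW, -, hWh, hobj, hmin⟩ := exists_isThread (𝟙 z) (k ≫ f)
    obtain ⟨V, hV, hVe, hVh, hVobj, -⟩ := exists_isThread k f
    obtain ⟨V', hV', hVe', hVh', hVobj', -⟩ := exists_isThread k' f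
    have := (H W hW (fun a ha => by rcases (hobj a).1 ha with rfl | rfl | rfl <;> assumption)
      (hW.target hWh)).unique
      ⟨hV, fun a => by rw [hVobj, hobj]; tauto, hmin V hV (hV.source hVe) (hV.comp hVe hVh)⟩
      ⟨hV', fun a => by rw [hVobj', hobj]; tauto,
        hmin V' hV' (hV'.source hVe') (h ▸ hV'.comp hVe' hVh')⟩
    subst this
    exact hV.parallel hVe hVe'
  refine ⟨S \ I, fun w hw => ⟨hw.1, ?_⟩, Set.sdiff_subset, fun w hw => ?_⟩
  · rintro rfl
    exact hw.2 ⟨hxy, ⟨f⟩, ⟨𝟙 _⟩⟩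
  by_cases hwI : w ∈ I
  · obtain ⟨hwy, ⟨e⟩, ⟨h⟩⟩ := hwI
    refine ⟨y, ⟨hy, fun hy' => hy'.1 rfl⟩, e, fun z hz g => ?_⟩
    have huniq' (k k' : z ⟶ y) (hk : k ≫ e = g) (hk' : k' ≫ e = g) : k = k' := by
      apply hmono hz.1
      rw [huniq hx (𝟙 x) f (e ≫ h), ← Category.assoc, ← Category.assoc, hk, hk']
    suffices ∃ k : z ⟶ y, k ≫ e = g from
      let ⟨k, hk⟩ := this
      ⟨k, hk, fun k' hk' => huniq' k' k hk' hk⟩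
    obtain ⟨W, hW, hWg, hWh, hobj, -⟩ := exists_isThread g h
    obtain ⟨V, ⟨hV, hVobj, hle⟩, -⟩ := H W hW (fun a ha => by
      rcases (hobj a).1 ha with rfl | rfl | rfl
      · exact hx
      · exact hw
      · exact hz.1) (hW.target hWh)
    have hVy : V (𝟙 y) := (hVobj y).2 (.inr rfl)
    have hVe : V e := by
      obtain ⟨e', he'⟩ | ⟨e', -⟩ := hV.total hVy (hV.target (hle _ hWg))
      · rwa [huniq hw h e e']
      · exact (hwy (eq_of_hom e' e)).elim
    -- If `y` comes after `z`, the thread supplies the factorization. If it comes before, then `z`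
    -- lies between `y` and `x`, and being outside `I` it must be `y` itself.
    obtain ⟨k, hk⟩ | ⟨k, hk⟩ := hV.total (hV.source (hle _ hWg)) hVy
    · exact ⟨k, hV.parallel (hV.comp hk hVe) (hle _ hWg)⟩
    · have hzy : z = y := by
        by_contra hzy
        exact hz.2 ⟨hzy, ⟨k⟩, ⟨g ≫ h⟩⟩
      subst hzy
      exact ⟨𝟙 z, by rw [Category.id_comp]; exact huniq hw h e g⟩
  · exact ⟨w, ⟨hw, hwI⟩, 𝟙 w, fun z _ g => ⟨g, by simp, by simp⟩⟩

theorem IsThreadDominatedBy.reflective {S : Set C} {x y : C} (hd : IsThreadDominatedBy S x y)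
    (f : x ⟶ y) : ∃ T : Set C, T ⊆ S \ {x} ∧ Reflective T S := by
  obtain ⟨T, hT, h⟩ := (isThreadDominatedBy_op_iff.2 hd).coreflective f.op
  refine ⟨T.unop, fun a ha => ⟨(hT ha).1, fun hax => (hT ha).2 (congrArg Opposite.op hax)⟩, ?_⟩
  exact coreflective_op_iff.1 h

/-- The passage from `S \ {x}` to `S` goes through the smaller `T`, which is (co)reflective in both.
-/
theorem IsThreadDominatedBy.zigzagContractible {S : Set C} {x y : C}
    (hd : IsThreadDominatedBy S x y) (h : ZigzagContractible (Full (S \ {x}))) :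
    ZigzagContractible (Full S) := by
  -- Domination applied to the vertex `x` alone shows that `x` and `y` are joined by an arrow.
  obtain ⟨W, ⟨hW, hobj, hle⟩, -⟩ := hd.2.2.2 _ (isThread_singleThread x)
    (fun a ha => singleThread_id_iff.1 ha ▸ hd.1) .id
  obtain ⟨f, -⟩ | ⟨f, -⟩ := hW.total (hle _ .id) ((hobj y).2 (.inr rfl))
  · obtain ⟨T, hT, hTS⟩ := hd.reflective f
    exact hTS.zigzagContractible_iff.1 ((hTS.mono hT Set.sdiff_subset).zigzagContractible_iff.2 h)
  · obtain ⟨T, hT, hTS⟩ := hd.coreflective f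
    exact hTS.zigzagContractible_iff.1 ((hTS.mono hT Set.sdiff_subset).zigzagContractible_iff.2 h)

end AcyclicCategory

/-! ### Faces in a Δ-complex and in its subcomplexes. -/

namespace DeltaComplex

theorem Face.eq_or_lt {X : DeltaComplex.{w}} {σ τ : X.Simplices} (h : X.Face σ τ) :
    σ = τ ∨ σ.1 < τ.1 := by
  induction h with
  | refl => exact .inl rfl
  | tail _ h ih =>
    obtain ⟨τ, v, hv⟩ := h
    right
    rcases ih with rfl | ih
    · exact Nat.lt_succ_self _
    · exact Nat.lt_succ_of_lt ih

/-- A descending sequence of faces that starts in `Y` never leaves it. -/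
theorem Subcomplex.face_iff {X : DeltaComplex.{w}} (Y : X.Subcomplex)
    (σ τ : Y.toDeltaComplex.Simplices) :
    Y.toDeltaComplex.Face σ τ ↔ X.Face ⟨σ.1, σ.2.1⟩ ⟨τ.1, τ.2.1⟩ := by
  constructor
  · intro h
    refine Relation.ReflTransGen.lift
      (fun σ : Y.toDeltaComplex.Simplices => (⟨σ.1, σ.2.1⟩ : X.Simplices)) ?_ _ _ h
    rintro _ _ ⟨ρ, v, hv⟩
    exact .d ρ.1 v.1 hv
  · have key (a b : X.Simplices) (h : X.Face a b) (hb : b.2 ∈ Y.carrier b.1) :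
        ∃ ha : a.2 ∈ Y.carrier a.1, Y.toDeltaComplex.Face ⟨a.1, a.2, ha⟩ ⟨b.1, b.2, hb⟩ := by
      induction h with
      | refl => exact ⟨hb, .refl⟩
      | tail _ h ih =>
        obtain ⟨ρ, v, hv⟩ := h
        obtain ⟨ha, hab⟩ := ih (Y.d_mem ρ hb v hv)
        exact ⟨ha, hab.tail (FaceOne.d (X := Y.toDeltaComplex) ⟨ρ, hb⟩
          ⟨v, Y.vertex_mem ρ hb v hv⟩ hv)⟩
    intro h
    exact (key _ _ h τ.2.2).2

end DeltaComplex

/-! ### The dictionary between chains and threads. -/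

namespace AcyclicCategory

variable {C : Type u} [Category.{v} C]

namespace Chain

/-- The morphisms between the objects of a chain that are composites of its morphisms. -/
inductive arrows {n : ℕ} (s : Chain C n) : MorphismProperty C
  | mk (i j : Fin (n + 1)) (h : i ≤ j) : arrows s (s.1.map (homOfLE h))

/-- Replaces dependent elimination, which fails when the endpoints are not variables, by equations
and one `HEq`. -/
theorem arrows.exists_index {n : ℕ} {s : Chain C n} {a b : C} {f : a ⟶ b} (hf : s.arrows f) :
    ∃ (i j : Fin (n + 1)) (h : i ≤ j), s.obj i = a ∧ s.obj j = b ∧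
      HEq (s.1.map (homOfLE h)) f := by
  cases hf with
  | mk i j h => exact ⟨i, j, h, rfl, rfl, HEq.rfl⟩

theorem arrows_id_iff {n : ℕ} (s : Chain C n) (a : C) :
    s.arrows (𝟙 a) ↔ ∃ i, s.obj i = a := by
  constructor
  · intro h
    obtain ⟨i, -, -, hi, -⟩ := h.exists_index
    exact ⟨i, hi⟩
  · rintro ⟨i, rfl⟩
    have h := arrows.mk (s := s) i i le_rfl
    rwa [show s.1.map (homOfLE (le_refl i)) = 𝟙 (s.obj i) from s.1.map_id i] at h

theorem mem_vertices_iff {n : ℕ} (s : Chain C n) (v : Chain C 0) :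
    v ∈ s.vertices ↔ s.arrows (𝟙 (v.obj 0)) := by
  rw [arrows_id_iff]
  constructor
  · rintro ⟨i, rfl⟩
    exact ⟨i, rfl⟩
  · rintro ⟨i, hi⟩
    exact ⟨i, by rw [← ofObj_obj v, ← hi]⟩

variable [AcyclicCategory C]

theorem isThread_arrows {n : ℕ} (s : Chain C n) : IsThread s.arrows where
  nonempty := ⟨s.obj 0, (s.arrows_id_iff _).2 ⟨0, rfl⟩⟩
  source h := (s.arrows_id_iff _).2 (let ⟨i, _, _, hi, _⟩ := h.exists_index; ⟨i, hi⟩)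
  target h := (s.arrows_id_iff _).2 (let ⟨_, j, _, _, hj, _⟩ := h.exists_index; ⟨j, hj⟩)
  comp hf hg := by
    obtain ⟨i, j, hij, rfl, rfl, hf⟩ := hf.exists_index
    obtain ⟨j', k, hjk, hj, rfl, hg⟩ := hg.exists_index
    obtain rfl := s.obj_injective hj
    obtain rfl := eq_of_heq hf
    obtain rfl := eq_of_heq hg
    have := arrows.mk (s := s) i k (hij.trans hjk)
    rwa [← homOfLE_comp hij hjk, s.1.map_comp] at this
  parallel hf hg := by
    obtain ⟨i, j, hij, rfl, rfl, hf⟩ := hf.exists_index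
    obtain ⟨i', j', hij', hi, hj, hg⟩ := hg.exists_index
    obtain rfl := s.obj_injective hi
    obtain rfl := s.obj_injective hj
    exact eq_of_heq (hf.symm.trans hg)
  total ha hb := by
    obtain ⟨i, rfl⟩ := (s.arrows_id_iff _).1 ha
    obtain ⟨j, rfl⟩ := (s.arrows_id_iff _).1 hb
    exact (le_total i j).imp (fun h => ⟨_, .mk i j h⟩) (fun h => ⟨_, .mk j i h⟩)

theorem arrows_face_le {n : ℕ} (s : Chain C (n + 1)) (i : Fin (n + 2)) :
    (s.face i).arrows ≤ s.arrows := by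
  rintro _ _ _ ⟨j, k, h⟩
  exact arrows.mk (s := s) _ _ ((Fin.succAboveOrderEmb i).monotone h)

theorem arrows_le_face {m n : ℕ} {s : Chain C m} {t : Chain C (n + 1)} (h : s.arrows ≤ t.arrows)
    {i : Fin (n + 2)} (hi : ¬ s.arrows (𝟙 (t.obj i))) : s.arrows ≤ (t.face i).arrows := by
  intro a b f hf
  have ha := s.isThread_arrows.source hf
  have hb := s.isThread_arrows.target hf
  obtain ⟨j, k, hjk, rfl, rfl, hf'⟩ := (h _ hf).exists_index
  obtain rfl := eq_of_heq hf'
  obtain ⟨j, rfl⟩ := Fin.exists_succAbove_eq (x := j) (y := i) (by rintro rfl; exact hi ha)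
  obtain ⟨k, rfl⟩ := Fin.exists_succAbove_eq (x := k) (y := i) (by rintro rfl; exact hi hb)
  exact arrows.mk (s := t.face i) j k ((Fin.succAboveOrderEmb i).le_iff_le.1 hjk)

theorem ncard_vertices {n : ℕ} (s : Chain C n) : s.vertices.ncard = n + 1 :=
  (classifyingSpace C).ncard_V s

/-- Matching the objects gives a strictly monotone self-map of `Fin (n + 1)`, hence the identity;
the arrows then agree as well. -/
theorem eq_of_arrows_eq {n : ℕ} {s t : Chain C n} (h : s.arrows = t.arrows) : s = t := by
  have hobj (i) : ∃ j, t.obj j = s.obj i := by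
    rw [← arrows_id_iff, ← h]
    exact (s.arrows_id_iff _).2 ⟨i, rfl⟩
  choose e he using hobj
  have hmono : StrictMono e := by
    refine Monotone.strictMono_of_injective (fun i j hij => ?_) fun i j hij => ?_
    · have hf := arrows.mk (s := s) i j hij
      rw [h] at hf
      obtain ⟨i', j', h', hi, hj, -⟩ := hf.exists_index
      rwa [t.obj_injective (hi.trans (he i).symm), t.obj_injective (hj.trans (he j).symm)] at h'
    · exact s.obj_injective ((he i).symm.trans (hij ▸ he j))
  have hid : e = id := hmono.eq_id
  subst hid
  refine Subtype.ext (Functor.hext (fun i => (he i).symm) fun i j f => ?_)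
  have hf := arrows.mk (s := s) i j (leOfHom f)
  rw [h] at hf
  obtain ⟨i', j', h', hi, hj, hf'⟩ := hf.exists_index
  obtain rfl := t.obj_injective (hi.trans (he i).symm)
  obtain rfl := t.obj_injective (hj.trans (he j).symm)
  exact hf'.symm

theorem faceOne_face {n : ℕ} (s : Chain C (n + 1)) (i : Fin (n + 2)) :
    (classifyingSpace C).FaceOne ⟨n, s.face i⟩ ⟨n + 1, s⟩ := by
  have hv : ofObj (s.obj i) ∈ s.vertices := ⟨i, rfl⟩
  have h := DeltaComplex.FaceOne.d (X := classifyingSpace C) s (ofObj (s.obj i)) hv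
  have hi : s.index _ hv = i := s.ofObj_comp_obj_injective (s.ofObj_obj_index _ hv)
  change (classifyingSpace C).FaceOne ⟨n, s.face (s.index _ hv)⟩ ⟨n + 1, s⟩ at h
  rwa [hi] at h

theorem arrows_le_of_face {σ τ : (classifyingSpace C).Simplices}
    (h : (classifyingSpace C).Face σ τ) : Chain.arrows σ.2 ≤ Chain.arrows τ.2 := by
  induction h with
  | refl => exact le_rfl
  | tail _ h ih =>
    obtain ⟨τ, v, hv⟩ := h
    exact ih.trans (arrows_face_le _ _)

/-- Recursion on the dimension of `t`: delete an object of `t` that does not occur in `s`. When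
there is none, the threads coincide and counting vertices equates the dimensions. -/
theorem face_of_arrows_le {m n : ℕ} {s : Chain C m} {t : Chain C n} (h : s.arrows ≤ t.arrows) :
    (classifyingSpace C).Face ⟨m, s⟩ ⟨n, t⟩ := by
  by_cases hi : ∃ i, ¬ s.arrows (𝟙 (t.obj i))
  · obtain ⟨i, hi⟩ := hi
    cases n with
    | zero =>
      obtain ⟨j, hj⟩ := (t.arrows_id_iff _).1 (h _ ((s.arrows_id_iff (s.obj 0)).2 ⟨0, rfl⟩))
      rw [show i = j from Fin.ext (by omega), hj] at hi
      exact (hi ((s.arrows_id_iff _).2 ⟨0, rfl⟩)).elim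
    | succ n => exact (face_of_arrows_le (arrows_le_face h hi)).tail (t.faceOne_face i)
  · push Not at hi
    have heq : s.arrows = t.arrows := s.isThread_arrows.eq_of_le t.isThread_arrows h fun a ha => by
      obtain ⟨i, rfl⟩ := (t.arrows_id_iff _).1 ha
      exact hi i
    have hV : s.vertices = t.vertices := Set.ext fun v => by
      rw [mem_vertices_iff, mem_vertices_iff, heq]
    have hmn : m + 1 = n + 1 := by rw [← s.ncard_vertices, ← t.ncard_vertices, hV]
    obtain rfl := Nat.succ_injective hmn
    rw [eq_of_arrows_eq heq]
    exact .refl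

theorem face_iff (σ τ : (classifyingSpace C).Simplices) :
    (classifyingSpace C).Face σ τ ↔ Chain.arrows σ.2 ≤ Chain.arrows τ.2 :=
  ⟨arrows_le_of_face, face_of_arrows_le⟩

end Chain

variable [AcyclicCategory C]

/-- The objects of a thread form a finite linear order, which is enumerated increasingly;
functoriality holds because parallel arrows of `W` are equal. -/
theorem IsThread.exists_chain [Finite C] {W : MorphismProperty C} (hW : IsThread W) :
    ∃ (n : ℕ) (s : Chain C n), s.arrows = W := by
  classical
  let T := {a : C // W (𝟙 a)}
  let _ : LinearOrder T :=
    { le := fun a b => ∃ f : a.1 ⟶ b.1, W f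
      le_refl := fun a => ⟨𝟙 _, a.2⟩
      le_trans := fun a b c ⟨f, hf⟩ ⟨g, hg⟩ => ⟨f ≫ g, hW.comp hf hg⟩
      le_antisymm := fun a b ⟨f, _⟩ ⟨g, _⟩ => Subtype.ext (eq_of_hom f g)
      le_total := fun a b => hW.total a.2 b.2
      toDecidableLE := Classical.decRel _ }
  let _ : Fintype T := Fintype.ofFinite T
  have hT : Nonempty T := let ⟨a, ha⟩ := hW.nonempty; ⟨⟨a, ha⟩⟩
  obtain ⟨n, hn⟩ := Nat.exists_eq_succ_of_ne_zero (Fintype.card_ne_zero (α := T))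
  let e : Fin (n + 1) ≃o T := monoEquivOfFin T hn
  have hle {i j : Fin (n + 1)} (h : i ≤ j) : ∃ f : (e i).1 ⟶ (e j).1, W f := e.monotone h
  let F : ComposableArrows C n :=
    { obj := fun i => (e i).1
      map := fun f => (hle (leOfHom f)).choose
      map_id := fun i => end_eq_id _ _
      map_comp := fun f g => hW.parallel (hle (leOfHom (f ≫ g))).choose_spec
        (hW.comp (hle (leOfHom f)).choose_spec (hle (leOfHom g)).choose_spec) }
  have hF {i j : Fin (n + 1)} (f : i ⟶ j) : W (F.map f) := (hle (leOfHom f)).choose_spec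
  let s : Chain C n := ⟨F, fun i h => by
    have h1 := e.injective (Subtype.ext (Chain.ne_of_isIdentity h))
    exact absurd h1 (Fin.castSucc_lt_succ (i := i)).ne⟩
  refine ⟨n, s, s.isThread_arrows.eq_of_le hW ?_ fun a ha => ?_⟩
  · rintro _ _ _ ⟨i, j, h⟩
    exact hF _
  · refine (s.arrows_id_iff a).2 ⟨e.symm ⟨a, ha⟩, ?_⟩
    exact congrArg Subtype.val (e.apply_symm_apply ⟨a, ha⟩)

/-! ### Full subcomplexes of the classifying space -/

/-- The classifying space of the full subcategory on `S`, as a subcomplex. -/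
def fullSubcomplex (S : Set C) : (classifyingSpace C).Subcomplex where
  carrier n := {s | ∀ i, Chain.obj s i ∈ S}
  vertex_mem := by
    rintro n s hs _ ⟨i, rfl⟩ _
    exact hs i
  d_mem _ hs _ _ _ := hs _

theorem whole_eq_fullSubcomplex :
    DeltaComplex.Subcomplex.whole (classifyingSpace C) = fullSubcomplex Set.univ := by
  ext n s
  exact iff_of_true trivial fun _ => trivial

theorem delete_fullSubcomplex (S : Set C) (v : Chain C 0) :
    (fullSubcomplex S).delete v = fullSubcomplex (S \ {v.obj 0}) := by
  ext n s
  have h : (classifyingSpace C).Face ⟨0, v⟩ ⟨n, s⟩ ↔ ∃ i, Chain.obj s i = v.obj 0 :=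
    ((classifyingSpace C).vertex_face_iff v ⟨n, s⟩).trans
      ((Chain.mem_vertices_iff s v).trans (Chain.arrows_id_iff s _))
  exact ⟨fun ⟨h1, h2⟩ i => ⟨h1 i, fun hi => h2 (h.2 ⟨i, hi⟩)⟩,
    fun h' => ⟨fun i => (h' i).1, fun hf => let ⟨i, hi⟩ := h.1 hf; (h' i).2 hi⟩⟩

/-- The morphisms of a simplex of a full subcomplex. -/
abbrev simplexArrows {S : Set C} (σ : (fullSubcomplex S).toDeltaComplex.Simplices) :
    MorphismProperty C := Chain.arrows σ.2.1

section simplexArrows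

variable {S : Set C}

theorem face_iff_simplexArrows_le (σ τ : (fullSubcomplex S).toDeltaComplex.Simplices) :
    (fullSubcomplex S).toDeltaComplex.Face σ τ ↔ simplexArrows σ ≤ simplexArrows τ :=
  ((fullSubcomplex S).face_iff σ τ).trans (Chain.face_iff _ _)

/-- Equal threads make each simplex a face of the other, and a proper face has smaller dimension. -/
theorem simplexArrows_injective :
    Function.Injective (simplexArrows (S := S)) := by
  intro σ τ h
  rcases ((face_iff_simplexArrows_le σ τ).2 h.le).eq_or_lt with h1 | h1
  · exact h1
  rcases ((face_iff_simplexArrows_le τ σ).2 h.ge).eq_or_lt with h2 | h2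
  · exact h2.symm
  · exact absurd h1 h2.asymm

theorem simplexArrows_id_mem (σ : (fullSubcomplex S).toDeltaComplex.Simplices) {a : C}
    (ha : simplexArrows σ (𝟙 a)) : a ∈ S := by
  obtain ⟨i, rfl⟩ := (Chain.arrows_id_iff _ _).1 ha
  exact σ.2.2 i

theorem exists_simplexArrows_eq [Finite C] {W : MorphismProperty C} (hW : IsThread W)
    (hS : ∀ a, W (𝟙 a) → a ∈ S) :
    ∃ σ : (fullSubcomplex S).toDeltaComplex.Simplices, simplexArrows σ = W := by
  obtain ⟨n, s, rfl⟩ := hW.exists_chain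
  exact ⟨⟨n, s, fun i => hS _ ((s.arrows_id_iff _).2 ⟨i, rfl⟩)⟩, rfl⟩

theorem mem_V_iff (σ : (fullSubcomplex S).toDeltaComplex.Simplices)
    (v : (fullSubcomplex S).toDeltaComplex.simplex 0) :
    v ∈ (fullSubcomplex S).toDeltaComplex.V σ.2 ↔ simplexArrows σ (𝟙 (Chain.obj v.1 0)) :=
  Chain.mem_vertices_iff _ _

theorem V_eq_union_iff (σ τ : (fullSubcomplex S).toDeltaComplex.Simplices)
    (v : (fullSubcomplex S).toDeltaComplex.simplex 0) :
    (fullSubcomplex S).toDeltaComplex.V τ.2 = (fullSubcomplex S).toDeltaComplex.V σ.2 ∪ {v} ↔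
      ∀ a, simplexArrows τ (𝟙 a) ↔ simplexArrows σ (𝟙 a) ∨ a = Chain.obj v.1 0 := by
  have hv (w : (fullSubcomplex S).toDeltaComplex.simplex 0) :
      w = v ↔ Chain.obj w.1 0 = Chain.obj v.1 0 := by
    refine ⟨fun h => by rw [h], fun h => Subtype.ext ?_⟩
    rw [← Chain.ofObj_obj w.1, h]
    exact Chain.ofObj_obj v.1
  have hmem (w : (fullSubcomplex S).toDeltaComplex.simplex 0) :
      (w ∈ (fullSubcomplex S).toDeltaComplex.V τ.2 ↔
        w ∈ (fullSubcomplex S).toDeltaComplex.V σ.2 ∪ {v}) ↔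
      (simplexArrows τ (𝟙 (Chain.obj w.1 0)) ↔
        simplexArrows σ (𝟙 (Chain.obj w.1 0)) ∨ Chain.obj w.1 0 = Chain.obj v.1 0) := by
    rw [Set.mem_union, Set.mem_singleton_iff, mem_V_iff, mem_V_iff, hv]
  rw [Set.ext_iff, forall_congr' hmem]
  refine ⟨fun h a => ?_, fun h w => h _⟩
  -- Vertices only test objects of `S`; any other object occurs on neither side.
  by_cases ha : a ∈ S
  · exact h ⟨Chain.ofObj a, fun _ => ha⟩
  · refine iff_of_false (fun h => ha (simplexArrows_id_mem τ h)) ?_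
    rintro (h | rfl)
    · exact ha (simplexArrows_id_mem σ h)
    · exact ha (v.2 0)

/-- Finiteness of `C` makes every thread in `S` come from a simplex, so quantifying over simplices
and over threads is the same. -/
theorem isDominatedBy_iff [Finite C] (x y : (fullSubcomplex S).toDeltaComplex.simplex 0) :
    (fullSubcomplex S).toDeltaComplex.IsDominatedBy x y ↔
      IsThreadDominatedBy S (Chain.obj x.1 0) (Chain.obj y.1 0) := by
  constructor
  · rintro ⟨hxy, H⟩
    refine ⟨x.2 0, y.2 0, fun h => hxy (Subtype.ext ?_), fun W hW hS hWx => ?_⟩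
    · rw [← Chain.ofObj_obj x.1, h]
      exact Chain.ofObj_obj y.1
    · obtain ⟨σ, rfl⟩ := exists_simplexArrows_eq hW hS
      obtain ⟨τ, ⟨h1, h2⟩, h3⟩ := H σ ((DeltaComplex.vertex_face_iff _ _ _).2
        ((mem_V_iff _ _).2 hWx))
      refine ⟨simplexArrows τ, ⟨Chain.isThread_arrows _, (V_eq_union_iff σ τ y).1 h1,
        (face_iff_simplexArrows_le _ _).1 h2⟩, fun W' ⟨hW', hobj, hle⟩ => ?_⟩
      obtain ⟨τ', rfl⟩ := exists_simplexArrows_eq (S := S) hW' fun a ha => by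
        rcases (hobj a).1 ha with h | rfl
        · exact hS a h
        · exact y.2 0
      exact congrArg simplexArrows (h3 τ' ⟨(V_eq_union_iff σ τ' y).2 hobj,
        (face_iff_simplexArrows_le _ _).2 hle⟩)
  · rintro ⟨-, -, hxy, H⟩
    refine ⟨fun h => hxy (by rw [h]), fun σ hσ => ?_⟩
    obtain ⟨W', ⟨h1, h2, h3⟩, h4⟩ := H (simplexArrows σ) (Chain.isThread_arrows _)
      (fun a ha => simplexArrows_id_mem σ ha)
      ((mem_V_iff _ _).1 ((DeltaComplex.vertex_face_iff _ _ _).1 hσ))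
    obtain ⟨τ, rfl⟩ := exists_simplexArrows_eq (S := S) h1 fun a ha => by
      rcases (h2 a).1 ha with h | rfl
      · exact simplexArrows_id_mem σ h
      · exact y.2 0
    exact ⟨τ, ⟨(V_eq_union_iff σ τ y).2 h2, (face_iff_simplexArrows_le _ _).2 h3⟩,
      fun τ' ⟨h5, h6⟩ => simplexArrows_injective (h4 _ ⟨Chain.isThread_arrows _,
        (V_eq_union_iff σ τ' y).1 h5, (face_iff_simplexArrows_le _ _).1 h6⟩)⟩

end simplexArrows

/-! ### Comparison of the two notions of collapse. -/

theorem elementaryStrongCollapse_fullSubcomplex [Finite C] {S T : Set C}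
    (h : ElementaryStrongCollapse S T) :
    DeltaComplex.Subcomplex.ElementaryStrongCollapse (fullSubcomplex S) (fullSubcomplex T) := by
  obtain ⟨x, hx, rfl, h⟩ := elementaryStrongCollapse_iff.1 h
  obtain ⟨y, hy⟩ : ∃ y, IsThreadDominatedBy S x y :=
    h.elim (fun h => h.isThreadDominatedBy hx) (fun h => h.isThreadDominatedBy hx)
  refine ⟨⟨Chain.ofObj x, fun _ => hx⟩, ⟨⟨Chain.ofObj y, fun _ => hy.2.1⟩, ?_⟩, ?_⟩
  · exact (isDominatedBy_iff _ _).2 hy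
  · exact (delete_fullSubcomplex S (Chain.ofObj x)).symm

theorem isSingleVertex_fullSubcomplex_iff {S : Set C} :
    (fullSubcomplex S).IsSingleVertex ↔ ∃ a, S = {a} := by
  constructor
  · rintro ⟨⟨v, hv⟩, -⟩
    refine ⟨v.obj 0, Set.ext fun a => ?_⟩
    have ha : Chain.ofObj a ∈ (fullSubcomplex S).carrier 0 ↔ Chain.ofObj a = v := by
      rw [hv]
      rfl
    refine ⟨fun h => ?_, ?_⟩
    · rw [← ha.1 fun _ => h]
      rfl
    · rintro rfl
      exact ha.2 (Chain.ofObj_obj v) 0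
  · rintro ⟨a, rfl⟩
    refine ⟨⟨Chain.ofObj a, Set.ext fun s => ⟨fun h => ?_, ?_⟩⟩, fun n => ?_⟩
    · rw [← Chain.ofObj_obj s, show Chain.obj s 0 = a from h 0]
      rfl
    · rintro rfl _
      rfl
    · refine Set.eq_empty_of_forall_notMem fun s hs => ?_
      have h01 : Chain.obj s 0 = Chain.obj s 1 := (hs 0).trans (hs 1).symm
      exact absurd (Chain.obj_injective s h01) Fin.zero_ne_one

/-- Deleting a vertex from a full subcomplex leaves a full subcomplex, so every stage of the
collapse is some `fullSubcomplex S`. Contractibility is carried back from the last stage. -/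
theorem zigzagContractible_of_strongCollapse [Finite C]
    {Y Z : (classifyingSpace C).Subcomplex} (h : DeltaComplex.Subcomplex.StrongCollapse Y Z)
    (hZ : Z.IsSingleVertex) (S : Set C) (hS : Y = fullSubcomplex S) :
    ZigzagContractible (Full S) := by
  induction h using Relation.ReflTransGen.head_induction_on generalizing S with
  | refl =>
    subst hS
    obtain ⟨a, rfl⟩ := isSingleVertex_fullSubcomplex_iff.1 hZ
    exact zigzagContractible_singleton a
  | head h _ ih =>
    subst hS
    obtain ⟨x, ⟨y, hxy⟩, rfl⟩ := h
    exact ((isDominatedBy_iff x y).1 hxy).zigzagContractible (ih _ (delete_fullSubcomplex S x.1))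

end AcyclicCategory

theorem mainTheorem1 {C : Type u} [Category.{v} C] [AcyclicCategory C]
    [Finite C] [∀ x y : C, Finite (x ⟶ y)] :
    AcyclicCategory.StronglyCollapsible C ↔
      (AcyclicCategory.classifyingSpace C).StronglyCollapsible := by
  constructor
  · rintro ⟨a, h⟩
    refine ⟨AcyclicCategory.fullSubcomplex {a}, ?_,
      AcyclicCategory.isSingleVertex_fullSubcomplex_iff.2 ⟨a, rfl⟩⟩
    rw [AcyclicCategory.whole_eq_fullSubcomplex]
    exact Relation.ReflTransGen.lift AcyclicCategory.fullSubcomplex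
      (fun _ _ => AcyclicCategory.elementaryStrongCollapse_fullSubcomplex) _ _ h
  · rintro ⟨Y, h, hY⟩
    exact AcyclicCategory.stronglyCollapsible_iff.2
      (AcyclicCategory.zigzagContractible_of_strongCollapse h hY _
        AcyclicCategory.whole_eq_fullSubcomplex)
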